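/- Let $\hat g_1,\dots,\hat g_m$ be linearly independent traceless Hermitian $N\times N$ matrices, $\hat H_0(\theta)=\sum_j\theta_j\hat g_j$ with $\theta\in\mathbb R^m$, $q(\theta)=\alpha\cdot\theta$ with $0\ne\alpha\in\mathbb R^m$, and $t>0$. Let $$\gamma=\inf\{\tfrac12\|\hat A\|_1:\ \hat A=\hat A^\dagger,\ \operatorname{Tr}\hat A=0,\ \operatorname{Tr}(\hat A\hat g_j)=\alpha_j\ \text{for all } j\},$$ where $\|\cdot\|_1$ is the trace norm. Then $\gamma>0$, the infimum is attained, and for every minimizer $\hat A$ and every orthonormal eigenbasis $(|k\rangle)_{k=0}^{N-1}$, $\hat A=\sum_k a_k|k\rangle\langle k|$, the following holds. Let $\mathcal X=\{k:a_k>0\}$, $\mathcal Y=\{k:a_k<0\}$, $\omega=e^{2\pi i/N}$, $\hat U_s=\sum_k\omega^{sk}|k\rangle\langle k|$ $(0\le s<N)$ and $\hat H_{\rm eff}=\sum_k\langle k|\hat H_0|k\rangle\,|k\rangle\langle k|$. Then $\mathcal X$ and $\mathcal Y$ are non-empty, and $\frac1N\sum_s\hat U_s^\dagger\hat H_0\hat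 U_s=\hat H_{\rm eff}$ for all $\theta$. Enumerate $\mathcal X$ and $\mathcal Y$ in any order, with first elements $x_0,y_0$ and last elements $x'',y''$; put $|\psi_{x,y}(\phi)\rangle=(|x\rangle+e^{i\phi}|y\rangle)/\sqrt2$. *Protocol.* Prepare $|\psi_{x_0,y_0}(\phi)\rangle$ and evolve for total time $t$, applying instantaneously the swaps (transpositions of basis vectors) $\hat S_{x,x'}$ from each element $x$ of $\mathcal X$ to the next one $x'$, after consecutive intervals of length $a_xt/\sum_{x\in\mathcal X}a_x$, and simultaneously the swaps $\hat S_{y,y'}$ through $\mathcal Y$ after consecutive intervals of length $a_yt/\sum_{y\in\mathcal Y}a_y$. In the *dephased* protocol the evolution between the swaps is generated by $\hat H_{\rm eff}$. In the *randomized* protocol with $L$ Trotter steps, $[0,t]$ is divided into $L$ equal steps, and during the $l$-th step the evolution is generated by $\hat U_{s_l}^\dagger\hat H_0\hat U_{s_l}$, with $s_1,\dots,s_L$ independent and uniform on $\{0,\dots,N-1\}$. Finally measure $i|x''\rangle\langle y''|+\text{h.c.}$, with outcome $o$. 1. For all $\theta$ and $\phi$, the final state of the dephased protocol is $|\psi_{x'',y''}(\phi+q(\theta)t/\gamma)\rangle$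 up to a global phase. 2. For every $\theta$, the unitary of the randomized protocol converges in probability, in spectral norm, to that of the dephased protocol as $L\to\infty$. 3. Let $q_0,\phi\in\mathbb R$ with $\cos\Phi_0\ne0$, $\Phi_0=\phi+q_0t/\gamma$, and consider the estimator $$q_{\rm est}=q_0+\frac{o+\sin\Phi_0}{-(t/\gamma)\cos\Phi_0}.$$ In the dephased protocol, at every $\theta_0$ with $q(\theta_0)=q_0$ it is locally unbiased ($\mathbb E_{\theta_0}[q_{\rm est}]=q_0$ and $\theta\mapsto\mathbb E_\theta[q_{\rm est}]$ is differentiable at $\theta_0$ with gradient $\alpha$) and has variance $$\operatorname{Var}_{\theta_0}(q_{\rm est})=\frac{\gamma^2}{t^2}.$$ 4. In the randomized protocol with $L$ steps, at every such $\theta_0$, $\theta\mapsto\mathbb E^{(L)}_{\theta}[q_{\rm est}]$ is differentiable for each $L$ and, as $L\to\infty$, $\mathbb E^{(L)}_{\theta_0}[q_{\rm est}]\to q_0$, $\nabla_\theta\mathbb E^{(L)}_{\theta}[q_{\rm est}]|_{\theta=\theta_0}\to\alpha$ and $\operatorname{Var}^{(L)}_{\theta_0}(q_{\rm est})\to\gamma^2/t^2$.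 Moreover $\mathbb E^{(L)}_\theta[q_{\rm est}]$ converges to its value $\mathbb E_\theta[q_{\rm est}]$ in the dephased protocol uniformly on bounded sets of $\theta$. -/

import Mathlib

open scoped Matrix Topology InnerProductSpace
open Filter MeasureTheory

noncomputable section

namespace FunctionEstimation

/-- The Hilbert space `ℂ^N`, with its Euclidean inner product. -/
abbrev Ket (N : ℕ) : Type := EuclideanSpace ℂ (Fin N)

/-- Operators on `ℂ^N`. -/
abbrev Op (N : ℕ) : Type := Matrix (Fin N) (Fin N) ℂ

/-- Orthonormal bases of `ℂ^N`, indexed by `0, …, N - 1`. -/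
abbrev ONB (N : ℕ) : Type := OrthonormalBasis (Fin N) ℂ (Ket N)

variable {N m : ℕ}

/-- The action of an operator on a vector. -/
def act (V : Op N) (ψ : Ket N) : Ket N := Matrix.toEuclideanLin V ψ

/-- The spectral norm (largest singular value). -/
def spectralNorm (V : Op N) : ℝ := ‖Matrix.toEuclideanCLM (n := Fin N) (𝕜 := ℂ) V‖

/-! ### The encoding Hamiltonian and the optimization problem -/

/-- The signal Hamiltonian `∑ j, θ j • g j`. -/
def hamiltonian (g : Fin m → Op N) (θ : Fin m → ℝ) : Op N := ∑ j, (θ j : ℂ) • g j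

/-- The trace norm `tr √(Aᴴ A)`: the sum of the square roots of the eigenvalues of `Aᴴ A`. -/
def traceNorm (A : Op N) : ℝ :=
  ∑ i, Real.sqrt ((Matrix.isHermitian_conjTranspose_mul_self A).eigenvalues i)

/-- `A` is Hermitian and traceless, and `Tr (A g_j) = α_j` for all `j`. -/
structure IsFeasible (g : Fin m → Op N) (α : Fin m → ℝ) (A : Op N) : Prop where
  isHermitian : A.IsHermitian
  trace_mul : ∀ j, (A * g j).trace = (α j : ℂ)
  trace_eq_zero : A.trace = 0

/-- `γ(g|α)`: the infimum of `‖A‖₁ / 2` over all feasible `A`. -/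
def gammaOpt (g : Fin m → Op N) (α : Fin m → ℝ) : ℝ :=
  sInf ((fun A : Op N => traceNorm A / 2) '' {A | IsFeasible g α A})

/-- `A` is feasible and attains `γ(g|α)`. -/
structure IsOptimal (g : Fin m → Op N) (α : Fin m → ℝ) (A : Op N) : Prop where
  isFeasible : IsFeasible g α A
  traceNorm_eq : traceNorm A / 2 = gammaOpt g α

/-! ### Dephasing in an orthonormal basis -/

/-- `|k⟩⟨l|` for the basis `K`. -/
def ketbra (K : ONB N) (k l : Fin N) : Op N :=
  Matrix.vecMulVec (WithLp.ofLp (K k)) (star (WithLp.ofLp (K l)))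

/-- The diagonal part `∑ k, ⟨k|H|k⟩ |k⟩⟨k|` of `H` in the basis `K`. -/
def diagPart (K : ONB N) (H : Op N) : Op N :=
  ∑ k, (⟪K k, act H (K k)⟫_ℂ) • ketbra K k k

/-- The diagonal unitary `U_s = ∑ k, ω ^ (s k) |k⟩⟨k|`, `ω = exp (2 π i / N)`. -/
def clock (K : ONB N) (s : Fin N) : Op N :=
  ∑ k : Fin N,
    Complex.exp (2 * Real.pi * Complex.I / N) ^ ((s : ℕ) * (k : ℕ)) • ketbra K k k

/-- Evolution under the exactly dephased Hamiltonian from time `u` to time `v`. -/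
def idealDrift (K : ONB N) (H : Op N) (u v : ℝ) : Op N :=
  NormedSpace.exp ((-(Complex.I * ((v - u : ℝ) : ℂ))) • diagPart K H)

/-- The length of the part of the `l`-th of the `L` equal steps of `[0, t]` that lies
in `[u, v]`. -/
def overlap (t : ℝ) (L l : ℕ) (u v : ℝ) : ℝ :=
  max 0 (min v (((l : ℝ) + 1) * (t / L)) - max u ((l : ℝ) * (t / L)))

/-- The randomized evolution from time `u` to time `v`: during the `l`-th step (of length `t / L`)
the system evolves under `H` conjugated by the pulse `U_{s l}`. Later steps stand to the left.
For `u = 0`, `v = t` this is the product over `l` of `U_{s l}ᴴ exp (-i H t / L) U_{s l}`. -/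
def qdriftDrift (K : ONB N) (H : Op N) (t : ℝ) (L : ℕ) (s : Fin L → Fin N) (u v : ℝ) : Op N :=
  (List.ofFn fun l : Fin L =>
    (clock K (s l))ᴴ
      * NormedSpace.exp ((-(Complex.I * (overlap t L (l : ℕ) u v : ℂ))) • H)
      * clock K (s l)).reverse.prod

/-! ### The swap protocol -/

/-- The swap `S_{k,l} = |k⟩⟨l| + |l⟩⟨k| + ∑_{j ≠ k, l} |j⟩⟨j|`. -/
def swapOp (K : ONB N) (k l : Fin N) : Op N :=
  ketbra K k l + ketbra K l k + ∑ j with j ≠ k ∧ j ≠ l, ketbra K j j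

/-- The GHZ-like state `(|x⟩ + e^{iφ} |y⟩) / √2`. -/
def ghz (K : ONB N) (x y : Fin N) (φ : ℝ) : Ket N :=
  (1 / Real.sqrt 2 : ℂ) • (K x + Complex.exp (Complex.I * φ) • K y)

/-- The time spent on `x` when a total time `t` is divided among the members of `l` in
proportion to `a`. -/
def dwell (a : Fin N → ℝ) (t : ℝ) (l : List (Fin N)) (x : Fin N) : ℝ :=
  a x * t / (l.map a).sum

/-- The swaps from each member of a list to the next one, with the times at which they are
applied: the first one `τ x` after time `s`, where `x` is the head of the list, and so on. -/
def swapGates (K : ONB N) (τ : Fin N → ℝ) : ℝ → List (Fin N) → List (ℝ × Op N)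
  | s, x :: x' :: r => (s + τ x, swapOp K x x') :: swapGates K τ (s + τ x) (x' :: r)
  | _, _ => []

open Classical in
/-- All swaps of the protocol in chronological order: those that run through `xs` and those that
run through `ys`. -/
def gates (K : ONB N) (a : Fin N → ℝ) (t : ℝ) (xs ys : List (Fin N)) : List (ℝ × Op N) :=
  List.merge (swapGates K (dwell a t xs) 0 xs) (swapGates K (dwell a t ys) 0 ys)
    (fun p q => decide (p.1 ≤ q.1))

/-- The total evolution from time `s` to time `T` for the drift `W` (`W u v` is the evolution
from time `u` to time `v`) interrupted by instantaneous gates at the listed times. -/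
def propagate (W : ℝ → ℝ → Op N) (T : ℝ) : ℝ → List (ℝ × Op N) → Op N
  | s, [] => W s T
  | s, (u, S) :: G => propagate W T u G * S * W s u

/-- The protocol run with the exactly dephased Hamiltonian. -/
def idealProtocol (K : ONB N) (a : Fin N → ℝ) (t : ℝ) (xs ys : List (Fin N)) (H : Op N) : Op N :=
  propagate (idealDrift K H) t 0 (gates K a t xs ys)

/-- The protocol run with `L` randomized steps, for the sequence `s` of random choices. -/
def qdriftProtocol (K : ONB N) (a : Fin N → ℝ) (t : ℝ) (xs ys : List (Fin N)) (H : Op N)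
    (L : ℕ) (s : Fin L → Fin N) : Op N :=
  propagate (qdriftDrift K H t L s) t 0 (gates K a t xs ys)

/-! ### Measurement and estimator -/

/-- Born's rule: the law of the outcome when the observable `O` is measured in the state `ψ`. -/
def bornLaw (O : Op N) (hO : O.IsHermitian) (ψ : Ket N) : Measure ℝ :=
  ∑ i, ENNReal.ofReal (‖⟪hO.eigenvectorBasis i, ψ⟫_ℂ‖ ^ 2) • Measure.dirac (hO.eigenvalues i)

/-- The observable `i |x⟩⟨y| + h.c.` -/
def readout (K : ONB N) (x y : Fin N) : Op N :=
  Complex.I • ketbra K x y + (Complex.I • ketbra K x y)ᴴ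

theorem readout_isHermitian (K : ONB N) (x y : Fin N) : (readout K x y).IsHermitian :=
  Matrix.isHermitian_add_transpose_self _

/-- The law of the outcome of the final measurement in the exactly dephased protocol, which starts
from the heads `x₀`, `y₀` of the two lists and reads out their last members. -/
def idealLaw (K : ONB N) (a : Fin N → ℝ) (t : ℝ) (x₀ : Fin N) (xs : List (Fin N)) (y₀ : Fin N)
    (ys : List (Fin N)) (φ : ℝ) (H : Op N) : Measure ℝ :=
  bornLaw _ (readout_isHermitian K ((x₀ :: xs).getLast (by simp)) ((y₀ :: ys).getLast (by simp)))
    (act (idealProtocol K a t (x₀ :: xs) (y₀ :: ys) H) (ghz K x₀ y₀ φ))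

/-- The law of the outcome of the final measurement in the randomized protocol with `L` steps, whose
random choices are independent and uniform on `{0, …, N - 1}`. -/
def qdriftLaw (K : ONB N) (a : Fin N → ℝ) (t : ℝ) (x₀ : Fin N) (xs : List (Fin N)) (y₀ : Fin N)
    (ys : List (Fin N)) (φ : ℝ) (H : Op N) (L : ℕ) : Measure ℝ :=
  ∑ s : Fin L → Fin N, ((N : ENNReal) ^ L)⁻¹ •
    bornLaw _ (readout_isHermitian K ((x₀ :: xs).getLast (by simp)) ((y₀ :: ys).getLast (by simp)))
      (act (qdriftProtocol K a t (x₀ :: xs) (y₀ :: ys) H L s) (ghz K x₀ y₀ φ))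

/-- The estimate of `q` from the outcome `o`. If the relative phase is `φ + q t / γ`, the mean outcome
is `-sin (φ + q t / γ)`; this relation is inverted to first order at the working point `q₀`. -/
def estimator (γ t φ q₀ : ℝ) (o : ℝ) : ℝ :=
  q₀ + (o - (-Real.sin (φ + q₀ * t / γ))) / (-(t / γ) * Real.cos (φ + q₀ * t / γ))

/-- The linear functional `θ ↦ ∑ j, α j * θ j`, whose value at `θ` is the quantity of interest. -/
def linearFunctional (α : Fin m → ℝ) : (Fin m → ℝ) →L[ℝ] ℝ :=
  ∑ j, α j • ContinuousLinearMap.proj j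

end FunctionEstimation

end

/-!
For a feasible Hermitian `A = ∑ a_k |k⟩⟨k|`, the constraints say
`q(θ) = Tr (A H₀(θ)) = ∑ a_k ⟨k|H₀|k⟩`, so `q` depends only on the diagonal of `H₀` in the
eigenbasis of `A`. Tracelessness and optimality make the positive eigenvalues add up to `γ` and the
negative ones to `-γ`. The infimum `γ` is a minimum of `∑ |a_k| / 2` over a compact set of pairs of a unitary
and a list of eigenvalues (`exists_isLeast`), and it is positive because `A = 0` is not feasible.

*Phase.* Under the dephased Hamiltonian each basis vector only acquires a phase, and the swaps move
the two branches of the state independently of each other through `𝒳` and `𝒴`. The energies along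
each branch are weighted by the dwell times `a_k t / (± γ)`, so the relative phase is `q t / γ`
(`act_propagate_chain`, `act_idealProtocol_ghz`).

*Randomization.* Consider one segment between consecutive gates. The mean of the randomized
evolution is a product of step averages, by independence. Each of these agrees with the dephased
step up to second order, because averaging over the clock unitaries dephases `H₀`. So the mean
evolution converges at rate `1 / L` (`norm_average_qdriftDrift_sub_le`). As all operators are
unitary, convergence of the mean implies convergence in mean square (`mean_norm_sq_sub_le`): writing
`V` for the randomized and `D` for the dephased evolution,
`𝔼 ‖(V - D) ψ‖² = 2 - 2 Re ⟨D ψ, (𝔼 V) ψ⟩` for unit `ψ`. Segments may share a step and hence be correlated, but their deviations merely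
add up in the norm (`mean_norm_propagate_sub_le`). This gives convergence in probability, by
Markov's inequality, and convergence of all expectation values, uniformly for bounded Hamiltonians.

*Gradients.* Along a line in parameter space the averaged expectation value extends to an entire
function bounded on a fixed disk uniformly in `L`. Cauchy's estimates bound its second derivative
on a smaller disk, and pointwise convergence then forces convergence of the first derivative
(`exists_taylor_bound_randomizedExpectation`, `tendsto_deriv_of_uniform_remainder`).

The estimator is affine in the outcome, so its mean and variance are determined by the expectation
values of the readout and of its square, which are `-sin Φ` and `1` in the state with relative
phase `Φ`.
-/

noncomputable section

namespace FunctionEstimation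

open scoped Matrix.Norms.L2Operator

variable {N m : ℕ}

/-! ### Operators acting on kets -/

theorem act_add_left (V W : Op N) (ψ : Ket N) : act (V + W) ψ = act V ψ + act W ψ := by
  simp [act]

theorem act_smul_left (c : ℂ) (V : Op N) (ψ : Ket N) : act (c • V) ψ = c • act V ψ := by
  simp [act]

theorem act_sum_left {ι : Type*} (s : Finset ι) (V : ι → Op N) (ψ : Ket N) :
    act (∑ i ∈ s, V i) ψ = ∑ i ∈ s, act (V i) ψ := by
  simp [act]

theorem act_sub_left (V W : Op N) (ψ : Ket N) : act (V - W) ψ = act V ψ - act W ψ := by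
  simp [act]

theorem act_add (V : Op N) (ψ χ : Ket N) : act V (ψ + χ) = act V ψ + act V χ := by
  simp [act]

theorem act_sub (V : Op N) (ψ χ : Ket N) : act V (ψ - χ) = act V ψ - act V χ := by
  simp [act]

theorem act_smul (V : Op N) (c : ℂ) (ψ : Ket N) : act V (c • ψ) = c • act V ψ := by
  simp [act]

theorem act_one (ψ : Ket N) : act (1 : Op N) ψ = ψ := by
  simp [act]

theorem act_mul (V W : Op N) (ψ : Ket N) : act (V * W) ψ = act V (act W ψ) := by
  simp [act, Matrix.toLpLin_apply]

theorem inner_act_conjTranspose (V : Op N) (ψ χ : Ket N) :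
    ⟪act Vᴴ ψ, χ⟫_ℂ = ⟪ψ, act V χ⟫_ℂ := by
  rw [act, Matrix.toEuclideanLin_conjTranspose_eq_adjoint, LinearMap.adjoint_inner_left, act]

theorem norm_act_le (V : Op N) (ψ : Ket N) : ‖act V ψ‖ ≤ ‖V‖ * ‖ψ‖ := by
  exact Matrix.l2_opNorm_mulVec V ψ

theorem op_ext (K : ONB N) {V W : Op N} (h : ∀ k, act V (K k) = act W (K k)) : V = W := by
  refine (Matrix.toEuclideanLin (𝕜 := ℂ) (m := Fin N) (n := Fin N)).injective ?_
  exact K.toBasis.ext fun k => by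
    rw [OrthonormalBasis.coe_toBasis]
    exact h k

theorem act_ketbra (K : ONB N) (k l : Fin N) (ψ : Ket N) :
    act (ketbra K k l) ψ = ⟪K l, ψ⟫_ℂ • K k := by
  ext i
  simp [act, ketbra, Matrix.toLpLin_apply, Matrix.vecMulVec_apply, Matrix.mulVec, dotProduct,
    PiLp.inner_apply, Finset.sum_mul]
  exact Finset.sum_congr rfl fun j _ => by ring

theorem act_ketbra_basis (K : ONB N) (k l p : Fin N) :
    act (ketbra K k l) (K p) = if l = p then K k else 0 := by
  rw [act_ketbra, orthonormal_iff_ite.mp K.orthonormal]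
  split_ifs <;> simp

theorem conjTranspose_ketbra (K : ONB N) (k l : Fin N) : (ketbra K k l)ᴴ = ketbra K l k := by
  ext i j
  simp [ketbra, Matrix.vecMulVec_apply, mul_comm]

theorem trace_ketbra_mul (K : ONB N) (k l : Fin N) (M : Op N) :
    (ketbra K k l * M).trace = ⟪K l, act M (K k)⟫_ℂ := by
  rw [ketbra, Matrix.vecMulVec_mul, Matrix.trace_vecMulVec]
  simp only [act, PiLp.inner_apply, Matrix.toLpLin_apply, dotProduct, Matrix.vecMul,
    Matrix.mulVec, RCLike.inner_apply, Finset.mul_sum, Finset.sum_mul]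
  rw [Finset.sum_comm]
  refine Finset.sum_congr rfl fun i _ => Finset.sum_congr rfl fun j _ => ?_
  simp
  ring

theorem trace_ketbra (K : ONB N) (k : Fin N) : (ketbra K k k).trace = 1 := by
  have := trace_ketbra_mul K k k 1
  rw [mul_one, act_one] at this
  rw [this, orthonormal_iff_ite.mp K.orthonormal]
  simp

theorem act_diagonal_basis (K : ONB N) (c : Fin N → ℂ) (p : Fin N) :
    act (∑ k, c k • ketbra K k k) (K p) = c p • K p := by
  simp [act_sum_left, act_smul_left, act_ketbra_basis]

/-! ### Unitary operators -/

theorem norm_act_of_unitary {V : Op N} (hV : Vᴴ * V = 1) (ψ : Ket N) : ‖act V ψ‖ = ‖ψ‖ := by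
  have h : ⟪act V ψ, act V ψ⟫_ℂ = ⟪ψ, ψ⟫_ℂ := by
    rw [← inner_act_conjTranspose, ← act_mul, hV, act_one]
  rw [inner_self_eq_norm_sq_to_K, inner_self_eq_norm_sq_to_K] at h
  have h2 : ‖act V ψ‖ ^ 2 = ‖ψ‖ ^ 2 := by exact_mod_cast h
  exact (pow_left_inj₀ (norm_nonneg _) (norm_nonneg _) two_ne_zero).mp h2

theorem norm_le_one_of_unitary {V : Op N} (hV : Vᴴ * V = 1) : ‖V‖ ≤ 1 := by
  have h : ‖V‖ * ‖V‖ ≤ 1 := by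
    rw [← Matrix.l2_opNorm_conjTranspose_mul_self, hV, Matrix.cstar_norm_def, map_one]
    exact ContinuousLinearMap.norm_id_le
  nlinarith [norm_nonneg V]

theorem unitary_mul {V W : Op N} (hV : Vᴴ * V = 1) (hW : Wᴴ * W = 1) :
    (V * W)ᴴ * (V * W) = 1 := by
  rw [Matrix.conjTranspose_mul, Matrix.mul_assoc, ← Matrix.mul_assoc Vᴴ, hV, Matrix.one_mul, hW]

theorem unitary_list_prod {l : List (Op N)} (h : ∀ V ∈ l, Vᴴ * V = 1) :
    l.prodᴴ * l.prod = 1 := by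
  induction l with
  | nil => simp
  | cons V l ih =>
    rw [List.prod_cons]
    exact unitary_mul (h V (by simp)) (ih fun W hW => h W (by simp [hW]))

theorem unitary_diagonal (K : ONB N) {c : Fin N → ℂ} (hc : ∀ k, ‖c k‖ = 1) :
    (∑ k, c k • ketbra K k k)ᴴ * (∑ k, c k • ketbra K k k) = 1 := by
  refine op_ext K fun p => ?_
  rw [Matrix.conjTranspose_sum]
  simp only [Matrix.conjTranspose_smul, conjTranspose_ketbra]
  rw [act_mul, act_diagonal_basis, act_smul, act_diagonal_basis, smul_smul, act_one]
  have : c p * star (c p) = 1 := by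
    rw [RCLike.star_def, RCLike.mul_conj, hc]
    simp
  rw [this, one_smul]

theorem clock_unitary (K : ONB N) (s : Fin N) : (clock K s)ᴴ * clock K s = 1 := by
  refine unitary_diagonal K fun k => ?_
  rw [norm_pow]
  have : (2 * Real.pi * Complex.I / N : ℂ) = ((2 * Real.pi / N : ℝ) : ℂ) * Complex.I := by
    push_cast; ring
  rw [this, Complex.norm_exp_ofReal_mul_I, one_pow]

theorem swapOp_basis (K : ONB N) (k l p : Fin N) (hkl : k ≠ l) :
    act (swapOp K k l) (K p) = K (Equiv.swap k l p) := by
  rw [swapOp, act_add_left, act_add_left, act_sum_left]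
  simp only [act_ketbra_basis]
  by_cases hk : p = k
  · subst hk
    rw [Equiv.swap_apply_left, if_neg hkl.symm, if_pos rfl, Finset.sum_eq_zero, zero_add, add_zero]
    intro j hj
    rw [if_neg]
    simp_all
  by_cases hl : p = l
  · subst hl
    rw [Equiv.swap_apply_right, if_neg hkl, if_pos rfl, Finset.sum_eq_zero, add_zero, add_zero]
    intro j hj
    rw [if_neg]
    simp_all
  rw [Equiv.swap_apply_of_ne_of_ne hk hl, if_neg (Ne.symm hl), if_neg (Ne.symm hk),
    Finset.sum_eq_single p]
  · simp
  · intro j _ hj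
    rw [if_neg hj]
  · intro h
    simp_all

theorem swapOp_isHermitian (K : ONB N) (k l : Fin N) : (swapOp K k l)ᴴ = swapOp K k l := by
  simp only [swapOp, Matrix.conjTranspose_add, Matrix.conjTranspose_sum, conjTranspose_ketbra]
  rw [add_comm (ketbra K l k)]

theorem swapOp_unitary (K : ONB N) {k l : Fin N} (hkl : k ≠ l) :
    (swapOp K k l)ᴴ * swapOp K k l = 1 := by
  refine op_ext K fun p => ?_
  rw [swapOp_isHermitian, act_mul, swapOp_basis K _ _ _ hkl, swapOp_basis K _ _ _ hkl,
    Equiv.swap_apply_self, act_one]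

theorem exp_unitary {H : Op N} (hH : H.IsHermitian) (r : ℝ) :
    (NormedSpace.exp ((-(Complex.I * (r : ℂ))) • H))ᴴ
      * NormedSpace.exp ((-(Complex.I * (r : ℂ))) • H) = 1 := by
  have hs : ((-(Complex.I * (r : ℂ))) • H)ᴴ = -((-(Complex.I * (r : ℂ))) • H) := by
    rw [Matrix.conjTranspose_smul, hH.eq, ← neg_smul]
    simp
  have hc : Commute (-((-(Complex.I * (r : ℂ))) • H)) ((-(Complex.I * (r : ℂ))) • H) :=
    (Commute.refl _).neg_left
  rw [← Matrix.exp_conjTranspose, hs, ← Matrix.exp_add_of_commute _ _ hc, neg_add_cancel,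
    NormedSpace.exp_zero]

theorem act_exp_of_eigenvector {A : Op N} {ψ : Ket N} {c : ℂ} (h : act A ψ = c • ψ) :
    act (NormedSpace.exp A) ψ = Complex.exp c • ψ := by
  have hpow : ∀ n : ℕ, act (A ^ n) ψ = c ^ n • ψ := by
    intro n
    induction n with
    | zero => simp [act_one]
    | succ n ih => rw [pow_succ, act_mul, h, act_smul, ih, smul_smul, pow_succ, mul_comm]
  let T : Op N →ₗ[ℂ] Ket N :=
    { toFun := fun V => act V ψ
      map_add' := fun V W => act_add_left V W ψ
      map_smul' := fun c V => act_smul_left c V ψ }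
  have hT : Continuous T := T.continuous_of_finiteDimensional
  have h1 := (NormedSpace.exp_series_hasSum_exp' (𝕂 := ℂ) A).map T hT
  have h2 := (NormedSpace.exp_series_hasSum_exp' (𝕂 := ℂ) c).smul_const ψ
  have h3 : (T ∘ fun n : ℕ => ((n.factorial : ℂ)⁻¹) • A ^ n)
      = fun n : ℕ => ((n.factorial : ℂ)⁻¹ • c ^ n) • ψ := by
    funext n
    change act _ ψ = _
    rw [act_smul_left, hpow, smul_smul, smul_eq_mul]
  rw [h3] at h1
  rw [Complex.exp_eq_exp_ℂ]
  exact h1.unique h2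

/-! ### Dephasing by averaging over the clock unitaries -/

theorem average_clock (K : ONB N) (H : Op N) :
    (N : ℂ)⁻¹ • ∑ s, (clock K s)ᴴ * H * clock K s = diagPart K H := by
  -- the `(k, p)` matrix element picks up the factor `(ω̄ ^ k ω ^ p) ^ s`, and the geometric
  -- sum over `s` vanishes unless `k = p`
  refine op_ext K fun p => ?_
  have hN : N ≠ 0 := fun h => by subst h; exact p.elim0
  set ω : ℂ := Complex.exp (2 * Real.pi * Complex.I / N) with hω
  have hprim : IsPrimitiveRoot ω N := Complex.isPrimitiveRoot_exp N hN
  have hnorm : ‖ω‖ = 1 := hprim.norm'_eq_one hN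
  have hterm : ∀ s : Fin N, act ((clock K s)ᴴ * H * clock K s) (K p)
      = ∑ k : Fin N, ((star ω ^ (k : ℕ) * ω ^ (p : ℕ)) ^ (s : ℕ)) • ⟪K k, act H (K p)⟫_ℂ • K k := by
    intro s
    have hs : (clock K s)ᴴ = ∑ k : Fin N, star (ω ^ ((s : ℕ) * (k : ℕ))) • ketbra K k k := by
      rw [clock, Matrix.conjTranspose_sum]
      simp only [Matrix.conjTranspose_smul, conjTranspose_ketbra, hω]
    rw [act_mul, act_mul, hs, clock, act_diagonal_basis, act_smul, act_smul, act_sum_left,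
      Finset.smul_sum]
    refine Finset.sum_congr rfl fun k _ => ?_
    rw [act_smul_left, act_ketbra, smul_smul, star_pow, ← hω, mul_pow, ← pow_mul, ← pow_mul,
      mul_comm (k : ℕ), mul_comm (p : ℕ), mul_comm]
  rw [act_smul_left, act_sum_left, Finset.sum_congr rfl fun s _ => hterm s, Finset.sum_comm,
    diagPart, act_diagonal_basis, Finset.sum_eq_single p]
  · have h1 : star ω ^ (p : ℕ) * ω ^ (p : ℕ) = 1 := by
      rw [← mul_pow, RCLike.star_def, RCLike.conj_mul, hnorm]
      simp
    simp only [h1, one_pow, one_smul, Finset.sum_const, Finset.card_univ, Fintype.card_fin]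
    rw [← Nat.cast_smul_eq_nsmul ℂ, smul_smul, inv_mul_cancel₀ (by exact_mod_cast hN), one_smul]
  · intro k _ hk
    rw [← Finset.sum_smul]
    set z : ℂ := star ω ^ (k : ℕ) * ω ^ (p : ℕ) with hz
    have hω1 : star ω * ω = 1 := by
      rw [RCLike.star_def, RCLike.conj_mul, hnorm]
      simp
    have hz1 : z ≠ 1 := by
      intro h
      apply hk
      have h2 : ω ^ (p : ℕ) = ω ^ (k : ℕ) := by
        calc ω ^ (p : ℕ) = (star ω * ω) ^ (k : ℕ) * ω ^ (p : ℕ) := by rw [hω1]; simp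
          _ = z * ω ^ (k : ℕ) := by rw [hz, mul_pow]; ring
          _ = _ := by rw [h, one_mul]
      exact Fin.ext (hprim.pow_inj p.2 k.2 h2).symm
    have hzN : z ^ N = 1 := by
      rw [hz, mul_pow, ← pow_mul, ← pow_mul, mul_comm (k : ℕ), mul_comm (p : ℕ), pow_mul, pow_mul,
        ← star_pow, hprim.pow_eq_one]
      simp
    have hgeom : ∑ s : Fin N, z ^ (s : ℕ) = 0 := by
      rw [Fin.sum_univ_eq_sum_range (fun i => z ^ i), geom_sum_eq hz1, hzN]
      simp
    rw [hgeom, zero_smul]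
  · simp

/-! ### The trace norm and the optimization problem -/

/-- The matrix whose columns are the vectors of the basis `K`. -/
def basisMatrix (K : ONB N) : Op N := Matrix.of fun i k => K k i

theorem basisMatrix_unitary (K : ONB N) : (basisMatrix K)ᴴ * basisMatrix K = 1 := by
  ext k l
  have := orthonormal_iff_ite.mp K.orthonormal k l
  rw [Matrix.one_apply, ← this, Matrix.mul_apply, PiLp.inner_apply]
  refine Finset.sum_congr rfl fun i _ => ?_
  simp [basisMatrix, mul_comm]

theorem sum_smul_ketbra_eq (K : ONB N) (a : Fin N → ℂ) :
    ∑ k, a k • ketbra K k k = basisMatrix K * Matrix.diagonal a * (basisMatrix K)ᴴ := by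
  ext i j
  rw [Matrix.mul_apply, Matrix.sum_apply]
  refine Finset.sum_congr rfl fun k _ => ?_
  simp [Matrix.mul_diagonal, ketbra, Matrix.vecMulVec_apply, basisMatrix]
  ring

theorem traceNorm_conj_diagonal {U : Op N} (hU : Uᴴ * U = 1) (a : Fin N → ℝ) :
    traceNorm (U * Matrix.diagonal (fun k => (a k : ℂ)) * Uᴴ) = ∑ k, |a k| := by
  -- compare the roots of the characteristic polynomial of `Aᴴ * A = U * diag (a ^ 2) * Uᴴ`
  set A : Op N := U * Matrix.diagonal (fun k => (a k : ℂ)) * Uᴴ with hA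
  have hsq : Aᴴ * A = U * (Matrix.diagonal (fun k => ((a k ^ 2 : ℝ) : ℂ)) * Uᴴ) := by
    have hd : (Matrix.diagonal (fun k => (a k : ℂ)))ᴴ = Matrix.diagonal (fun k => (a k : ℂ)) := by
      rw [Matrix.diagonal_conjTranspose]
      congr 1
      funext k
      simp
    have hAA : Aᴴ = A := by
      rw [hA, Matrix.conjTranspose_mul, Matrix.conjTranspose_mul, hd,
        Matrix.conjTranspose_conjTranspose, Matrix.mul_assoc]
    rw [hAA, hA]
    calc U * Matrix.diagonal (fun k => (a k : ℂ)) * Uᴴ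
          * (U * Matrix.diagonal (fun k => (a k : ℂ)) * Uᴴ)
        = U * (Matrix.diagonal (fun k => (a k : ℂ)) * (Uᴴ * U)
          * Matrix.diagonal (fun k => (a k : ℂ)) * Uᴴ) := by simp only [Matrix.mul_assoc]
      _ = _ := by
          rw [hU, Matrix.mul_one, Matrix.diagonal_mul_diagonal]
          congr 3
          funext k
          push_cast
          ring
  have hherm := Matrix.isHermitian_conjTranspose_mul_self A
  have hroots := hherm.roots_charpoly_eq_eigenvalues
  have hchar : (Aᴴ * A).charpoly = ∏ k, (Polynomial.X - Polynomial.C ((a k ^ 2 : ℝ) : ℂ)) := by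
    rw [hsq, Matrix.charpoly_mul_comm, Matrix.mul_assoc, hU, Matrix.mul_one,
      Matrix.charpoly_diagonal]
  have hprod : ∏ k, (Polynomial.X - Polynomial.C ((a k ^ 2 : ℝ) : ℂ))
      = ((Finset.univ.val.map fun k => ((a k ^ 2 : ℝ) : ℂ)).map
          fun z => Polynomial.X - Polynomial.C z).prod := by
    rw [Multiset.map_map]
    rfl
  rw [hchar, hprod, Polynomial.roots_multiset_prod_X_sub_C] at hroots
  have h2 := congrArg (fun s => (s.map fun z : ℂ => Real.sqrt z.re).sum) hroots
  simp only [Multiset.map_map] at h2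
  calc traceNorm A = ∑ i, Real.sqrt (hherm.eigenvalues i) := rfl
    _ = ∑ k, Real.sqrt (a k ^ 2) := h2.symm
    _ = ∑ k, |a k| := by simp only [Real.sqrt_sq_eq_abs]

theorem traceNorm_sum_smul_ketbra (K : ONB N) (a : Fin N → ℝ) :
    traceNorm (∑ k, (a k : ℂ) • ketbra K k k) = ∑ k, |a k| := by
  rw [sum_smul_ketbra_eq, traceNorm_conj_diagonal (basisMatrix_unitary K)]

theorem exists_unitary_diagonal {A : Op N} (hA : A.IsHermitian) :
    ∃ (U : Op N) (a : Fin N → ℝ), Uᴴ * U = 1 ∧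
      A = U * Matrix.diagonal (fun k => (a k : ℂ)) * Uᴴ := by
  refine ⟨hA.eigenvectorUnitary, hA.eigenvalues, ?_, ?_⟩
  · rw [← Matrix.star_eq_conjTranspose]
    exact Unitary.coe_star_mul_self _
  · have := hA.spectral_theorem
    rw [Unitary.conjStarAlgAut_apply] at this
    exact this

theorem isHermitian_hamiltonian {g : Fin m → Op N} (hherm : ∀ j, (g j).IsHermitian)
    (θ : Fin m → ℝ) : (hamiltonian g θ).IsHermitian := by
  rw [Matrix.IsHermitian, hamiltonian, Matrix.conjTranspose_sum]
  refine Finset.sum_congr rfl fun j _ => ?_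
  rw [Matrix.conjTranspose_smul, (hherm j).eq]
  simp

theorem trace_mul_im_eq_zero {A B : Op N} (hA : A.IsHermitian) (hB : B.IsHermitian) :
    (A * B).trace.im = 0 := by
  rw [← Complex.conj_eq_iff_im, ← RCLike.star_def, ← Matrix.trace_conjTranspose,
    Matrix.conjTranspose_mul, hA.eq, hB.eq, Matrix.trace_mul_comm]

open scoped ComplexOrder in
/-- The Gram matrix `Tr (g_i g_j)` of linearly independent Hermitian matrices is nondegenerate, so
the constraints can be met within the real span of the `g_j`. -/
theorem exists_isFeasible {g : Fin m → Op N} (hherm : ∀ j, (g j).IsHermitian)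
    (htrace : ∀ j, (g j).trace = 0) (hindep : LinearIndependent ℝ g) (α : Fin m → ℝ) :
    ∃ A, IsFeasible g α A := by
  let T : (Fin m → ℝ) →ₗ[ℝ] (Fin m → ℝ) :=
    { toFun := fun c j => (hamiltonian g c * g j).trace.re
      map_add' := fun c d => by
        funext j
        simp [hamiltonian, add_smul, Finset.sum_add_distrib, add_mul]
      map_smul' := fun r c => by
        funext j
        simp only [hamiltonian, Pi.smul_apply, smul_eq_mul, RingHom.id_apply, Finset.sum_mul,
          Matrix.trace_sum, Complex.re_sum, Finset.mul_sum, Matrix.smul_mul, Matrix.trace_smul]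
        refine Finset.sum_congr rfl fun i _ => ?_
        rw [Complex.ofReal_mul, mul_assoc, Complex.re_ofReal_mul] }
  have hinj : Function.Injective T := by
    refine (injective_iff_map_eq_zero T).mpr fun c hc => ?_
    have hG := isHermitian_hamiltonian hherm c
    have h0 : ∀ j, (hamiltonian g c * g j).trace = 0 := fun j => by
      apply Complex.ext
      · exact congrFun hc j
      · exact trace_mul_im_eq_zero hG (hherm j)
    have h1 : ((hamiltonian g c)ᴴ * hamiltonian g c).trace = 0 := by
      rw [hG.eq]
      conv_lhs => arg 1; arg 2; rw [hamiltonian]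
      simp [Finset.mul_sum, Matrix.trace_sum, h0]
    have h2 : hamiltonian g c = 0 := Matrix.trace_conjTranspose_mul_self_eq_zero_iff.mp h1
    have h3 : ∑ j, c j • g j = 0 := by
      rw [← h2, hamiltonian]
      refine Finset.sum_congr rfl fun j _ => ?_
      ext p q
      simp
    funext j
    exact Fintype.linearIndependent_iff.mp hindep c h3 j
  obtain ⟨c, hc⟩ := (LinearMap.injective_iff_surjective.mp hinj) α
  refine ⟨hamiltonian g c, isHermitian_hamiltonian hherm c, fun j => ?_, ?_⟩
  · apply Complex.ext
    · exact congrFun hc j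
    · rw [trace_mul_im_eq_zero (isHermitian_hamiltonian hherm c) (hherm j), Complex.ofReal_im]
  · simp [hamiltonian, Matrix.trace_sum, htrace]

/-- The infimum defining `γ` is attained: it is a minimum of a continuous function over pairs
of a unitary matrix and a bounded list of eigenvalues. -/
theorem exists_isLeast {g : Fin m → Op N} {α : Fin m → ℝ} (hne : ∃ A, IsFeasible g α A) :
    ∃ A, IsFeasible g α A ∧ ∀ B, IsFeasible g α B → traceNorm A ≤ traceNorm B := by
  have : ProperSpace (Op N) := FiniteDimensional.proper ℂ _
  let F : Op N × (Fin N → ℝ) → Op N :=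
    fun p => p.1 * Matrix.diagonal (fun k => (p.2 k : ℂ)) * p.1ᴴ
  have hF : Continuous F := by
    have h1 : Continuous fun p : Op N × (Fin N → ℝ) => p.1 := continuous_fst
    have h2 : Continuous fun p : Op N × (Fin N → ℝ) =>
        Matrix.diagonal (fun k => (p.2 k : ℂ)) :=
      Continuous.matrix_diagonal (by fun_prop)
    exact (h1.matrix_mul h2).matrix_mul h1.matrix_conjTranspose
  obtain ⟨A₀, hA₀⟩ := hne
  obtain ⟨U₀, a₀, hU₀, rfl⟩ := exists_unitary_diagonal hA₀.isHermitian
  set M : ℝ := ∑ k, |a₀ k| with hM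
  let S : Set (Op N × (Fin N → ℝ)) :=
    (Metric.closedBall 0 1 ×ˢ Metric.closedBall 0 M)
      ∩ ({p | p.1ᴴ * p.1 = 1} ∩ {p | ∀ j, (F p * g j).trace = (α j : ℂ)} ∩ {p | (F p).trace = 0})
  have hS : IsCompact S := by
    refine ((isCompact_closedBall _ _).prod (isCompact_closedBall _ _)).inter_right ?_
    refine ((isClosed_eq ?_ continuous_const).inter ?_).inter (isClosed_eq ?_ continuous_const)
    · exact continuous_fst.matrix_conjTranspose.matrix_mul continuous_fst
    · have : {p | ∀ j, (F p * g j).trace = (α j : ℂ)}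
          = ⋂ j, {p | (F p * g j).trace = (α j : ℂ)} := by
        ext p
        simp
      rw [this]
      exact isClosed_iInter fun j =>
        isClosed_eq (hF.matrix_mul continuous_const).matrix_trace continuous_const
    · exact hF.matrix_trace
  have hFherm : ∀ p, (F p).IsHermitian := fun p => by
    refine Matrix.isHermitian_mul_mul_conjTranspose _ ?_
    exact Matrix.isHermitian_diagonal_of_self_adjoint _ (by
      rw [IsSelfAdjoint]; funext k; simp)
  have hmem : ∀ (U : Op N) (a : Fin N → ℝ), Uᴴ * U = 1 → IsFeasible g α (F (U, a)) →
      ∑ k, |a k| ≤ M → (U, a) ∈ S := by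
    intro U a hU hfeas ha
    refine ⟨⟨?_, ?_⟩, ⟨hU, hfeas.trace_mul⟩, hfeas.trace_eq_zero⟩
    · rw [mem_closedBall_zero_iff]
      exact norm_le_one_of_unitary hU
    · rw [mem_closedBall_zero_iff]
      refine (pi_norm_le_iff_of_nonneg (Finset.sum_nonneg fun k _ => abs_nonneg _)).mpr fun k => ?_
      exact (Finset.single_le_sum (f := fun k => |a k|) (fun k _ => abs_nonneg _)
        (Finset.mem_univ k)).trans ha
  obtain ⟨⟨U, a⟩, hUS, hmin⟩ := hS.exists_isMinOn ⟨_, hmem U₀ a₀ hU₀ hA₀ le_rfl⟩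
    (f := fun p => ∑ k, |p.2 k|) (by fun_prop)
  have hU : Uᴴ * U = 1 := hUS.2.1.1
  refine ⟨F (U, a), ⟨hFherm _, hUS.2.1.2, hUS.2.2⟩, fun B hB => ?_⟩
  obtain ⟨V, b, hV, rfl⟩ := exists_unitary_diagonal hB.isHermitian
  rw [traceNorm_conj_diagonal hU, traceNorm_conj_diagonal hV]
  by_cases hb : ∑ k, |b k| ≤ M
  · exact hmin (hmem V b hV hB hb)
  · exact (hmin (hmem U₀ a₀ hU₀ hA₀ le_rfl)).trans (not_le.mp hb).le

theorem exists_isOptimal {g : Fin m → Op N} {α : Fin m → ℝ} (hne : ∃ A, IsFeasible g α A) :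
    ∃ A, IsOptimal g α A := by
  obtain ⟨A, hA, hmin⟩ := exists_isLeast hne
  have hleast : IsLeast ((fun A : Op N => traceNorm A / 2) '' {A | IsFeasible g α A})
      (traceNorm A / 2) := by
    refine ⟨⟨A, hA, rfl⟩, ?_⟩
    rintro _ ⟨B, hB, rfl⟩
    exact div_le_div_of_nonneg_right (hmin B hB) zero_le_two
  exact ⟨A, hA, hleast.csInf_eq.symm⟩

theorem gammaOpt_pos {g : Fin m → Op N} {α : Fin m → ℝ} (hα : α ≠ 0)
    (hne : ∃ A, IsFeasible g α A) : 0 < gammaOpt g α := by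
  obtain ⟨A, hA⟩ := exists_isOptimal hne
  rw [← hA.traceNorm_eq]
  obtain ⟨U, a, hU, rfl⟩ := exists_unitary_diagonal hA.isFeasible.isHermitian
  rw [traceNorm_conj_diagonal hU]
  by_contra! h
  apply hα
  have h0 : ∑ k, |a k| = 0 :=
    le_antisymm (by linarith) (Finset.sum_nonneg fun k _ => abs_nonneg _)
  have ha : ∀ k, a k = 0 := fun k =>
    abs_eq_zero.mp ((Finset.sum_eq_zero_iff_of_nonneg fun k _ => abs_nonneg (a k)).mp h0 k
      (Finset.mem_univ k))
  funext j
  have := hA.isFeasible.trace_mul j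
  simp only [ha] at this
  simpa using this.symm

/-! ### Eigenvalues of an optimal operator -/

theorem sum_eigenvalues_eq_zero {g : Fin m → Op N} {α : Fin m → ℝ} {K : ONB N} {a : Fin N → ℝ}
    (hA : IsFeasible g α (∑ k, (a k : ℂ) • ketbra K k k)) : ∑ k, a k = 0 := by
  have := hA.trace_eq_zero
  simp only [Matrix.trace_sum, Matrix.trace_smul, trace_ketbra, smul_eq_mul, mul_one] at this
  exact_mod_cast this

theorem sum_abs_eigenvalues {g : Fin m → Op N} {α : Fin m → ℝ} {K : ONB N} {a : Fin N → ℝ}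
    (hA : IsOptimal g α (∑ k, (a k : ℂ) • ketbra K k k)) : ∑ k, |a k| = 2 * gammaOpt g α := by
  rw [← hA.traceNorm_eq, traceNorm_sum_smul_ketbra]
  ring

theorem list_sum_eq_sum_ite {l : List (Fin N)} (hl : l.Nodup) {p : Fin N → Prop}
    [DecidablePred p] (hp : ∀ k, k ∈ l ↔ p k) (f : Fin N → ℝ) :
    (l.map f).sum = ∑ k, if p k then f k else 0 := by
  rw [← List.sum_toFinset f hl, ← Finset.sum_filter]
  congr 1
  ext k
  simp [hp]

theorem sum_positive_eigenvalues {g : Fin m → Op N} {α : Fin m → ℝ} {K : ONB N} {a : Fin N → ℝ}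
    (hA : IsOptimal g α (∑ k, (a k : ℂ) • ketbra K k k)) :
    (∑ k, if 0 < a k then a k else 0) = gammaOpt g α := by
  have h1 := sum_eigenvalues_eq_zero hA.isFeasible
  have h2 := sum_abs_eigenvalues hA
  have h3 : ∑ k, (if 0 < a k then a k else 0) = ∑ k, (a k + |a k|) / 2 := by
    refine Finset.sum_congr rfl fun k _ => ?_
    split_ifs with h
    · rw [abs_of_pos h]; ring
    · rw [abs_of_nonpos (not_lt.mp h)]; ring
  rw [h3, ← Finset.sum_div, Finset.sum_add_distrib, h1, h2]
  ring

theorem sum_negative_eigenvalues {g : Fin m → Op N} {α : Fin m → ℝ} {K : ONB N} {a : Fin N → ℝ}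
    (hA : IsOptimal g α (∑ k, (a k : ℂ) • ketbra K k k)) :
    (∑ k, if a k < 0 then a k else 0) = -gammaOpt g α := by
  have h1 := sum_eigenvalues_eq_zero hA.isFeasible
  have h2 := sum_abs_eigenvalues hA
  have h3 : ∑ k, (if a k < 0 then a k else 0) = ∑ k, (a k - |a k|) / 2 := by
    refine Finset.sum_congr rfl fun k _ => ?_
    split_ifs with h
    · rw [abs_of_neg h]; ring
    · rw [abs_of_nonneg (not_lt.mp h)]; ring
  rw [h3, ← Finset.sum_div, Finset.sum_sub_distrib, h1, h2]
  ring

theorem linearFunctional_apply (α θ : Fin m → ℝ) : linearFunctional α θ = ∑ j, α j * θ j := by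
  simp [linearFunctional]

/-- The quantity of interest is the expectation of the Hamiltonian in the feasible operator. -/
theorem sum_eigenvalues_mul_expectation {g : Fin m → Op N} {α : Fin m → ℝ} {K : ONB N}
    {a : Fin N → ℝ} (hA : IsFeasible g α (∑ k, (a k : ℂ) • ketbra K k k)) (θ : Fin m → ℝ) :
    ∑ k, a k * (⟪K k, act (hamiltonian g θ) (K k)⟫_ℂ).re = linearFunctional α θ := by
  have h1 : ((∑ k, (a k : ℂ) • ketbra K k k) * hamiltonian g θ).trace
      = ((linearFunctional α θ : ℝ) : ℂ) := by
    conv_lhs => arg 1; arg 2; rw [hamiltonian]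
    rw [Finset.mul_sum, Matrix.trace_sum, linearFunctional_apply]
    push_cast
    refine Finset.sum_congr rfl fun j _ => ?_
    rw [Matrix.mul_smul, Matrix.trace_smul, hA.trace_mul j, smul_eq_mul, mul_comm]
  have h2 := congrArg Complex.re h1
  rw [Complex.ofReal_re, Finset.sum_mul, Matrix.trace_sum, Complex.re_sum] at h2
  rw [← h2]
  refine Finset.sum_congr rfl fun k _ => ?_
  rw [Matrix.smul_mul, Matrix.trace_smul, trace_ketbra_mul, smul_eq_mul, Complex.re_ofReal_mul]

/-! ### The gate sequence -/

/-- `IsInterleaving l₁ l₂ l`: the list `l` is a shuffle of `l₁` and `l₂` that keeps the order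
within each of them. -/
inductive IsInterleaving {β : Type*} : List β → List β → List β → Prop
  | nil : IsInterleaving [] [] []
  | left (p : β) {l₁ l₂ l : List β} :
      IsInterleaving l₁ l₂ l → IsInterleaving (p :: l₁) l₂ (p :: l)
  | right (p : β) {l₁ l₂ l : List β} :
      IsInterleaving l₁ l₂ l → IsInterleaving l₁ (p :: l₂) (p :: l)

namespace IsInterleaving

variable {β : Type*}

theorem symm {l₁ l₂ l : List β} (h : IsInterleaving l₁ l₂ l) : IsInterleaving l₂ l₁ l := by
  induction h with
  | nil => exact nil
  | left p _ ih => exact right p ih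
  | right p _ ih => exact left p ih

theorem nil_left (l : List β) : IsInterleaving [] l l := by
  induction l with
  | nil => exact nil
  | cons p l ih => exact right p ih

theorem merge (le : β → β → Bool) (l₁ l₂ : List β) :
    IsInterleaving l₁ l₂ (l₁.merge l₂ le) := by
  induction l₁ generalizing l₂ with
  | nil => rw [List.nil_merge]; exact nil_left l₂
  | cons p l₁ ih₁ =>
    induction l₂ with
    | nil => rw [List.merge_right]; exact (nil_left _).symm
    | cons q l₂ ih₂ =>
      rw [List.cons_merge_cons]
      split_ifs
      · exact left p (ih₁ _)
      · exact right q ih₂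

end IsInterleaving

theorem swapGates_fixes (K : ONB N) (τ : Fin N → ℝ) (s : ℝ) {l : List (Fin N)} (hl : l.Nodup)
    {k : Fin N} (hk : k ∉ l) : ∀ p ∈ swapGates K τ s l, act p.2 (K k) = K k := by
  induction l generalizing s with
  | nil => simp [swapGates]
  | cons x l ih =>
    cases l with
    | nil => simp [swapGates]
    | cons x' r =>
      intro p hp
      rw [swapGates, List.mem_cons] at hp
      simp only [List.mem_cons, not_or] at hk
      rcases hp with rfl | hp
      · have hxx : x ≠ x' := fun h => by simp [h] at hl
        rw [swapOp_basis K _ _ _ hxx, Equiv.swap_apply_of_ne_of_ne hk.1 hk.2.1]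
      · exact ih _ hl.of_cons (by simp [hk]) p hp

theorem swapGates_unitary (K : ONB N) (τ : Fin N → ℝ) (s : ℝ) {l : List (Fin N)}
    (hl : l.Nodup) : ∀ p ∈ swapGates K τ s l, p.2ᴴ * p.2 = 1 := by
  induction l generalizing s with
  | nil => simp [swapGates]
  | cons x l ih =>
    cases l with
    | nil => simp [swapGates]
    | cons x' r =>
      intro p hp
      rw [swapGates, List.mem_cons] at hp
      rcases hp with rfl | hp
      · exact swapOp_unitary K fun h => by simp [h] at hl
      · exact ih _ hl.of_cons p hp

theorem swapGates_time_mem (K : ONB N) (τ : Fin N → ℝ) (s : ℝ) {l : List (Fin N)}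
    (hτ : ∀ k ∈ l, 0 ≤ τ k) :
    ∀ p ∈ swapGates K τ s l, s ≤ p.1 ∧ p.1 ≤ s + (l.map τ).sum := by
  induction l generalizing s with
  | nil => simp [swapGates]
  | cons x l ih =>
    cases l with
    | nil => simp [swapGates]
    | cons x' r =>
      intro p hp
      rw [swapGates, List.mem_cons] at hp
      have hx : 0 ≤ τ x := hτ x (by simp)
      have hr : ∀ k ∈ x' :: r, 0 ≤ τ k := fun k hk => hτ k (List.mem_cons_of_mem _ hk)
      rw [List.map_cons, List.sum_cons]
      rcases hp with rfl | hp
      · have : 0 ≤ ((x' :: r).map τ).sum := List.sum_nonneg (by simpa using hr)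
        constructor <;> simp only <;> linarith
      · have := ih (s + τ x) hr p hp
        constructor <;> linarith [this.1, this.2]

theorem swapGates_pairwise (K : ONB N) (τ : Fin N → ℝ) (s : ℝ) {l : List (Fin N)}
    (hτ : ∀ k ∈ l, 0 ≤ τ k) : (swapGates K τ s l).Pairwise fun p q => p.1 ≤ q.1 := by
  induction l generalizing s with
  | nil => simp [swapGates]
  | cons x l ih =>
    cases l with
    | nil => simp [swapGates]
    | cons x' r =>
      have hr : ∀ k ∈ x' :: r, 0 ≤ τ k := fun k hk => hτ k (List.mem_cons_of_mem _ hk)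
      rw [swapGates, List.pairwise_cons]
      exact ⟨fun p hp => (swapGates_time_mem K τ _ hr p hp).1, ih _ hr⟩

theorem dwell_sum (a : Fin N → ℝ) (t : ℝ) {l : List (Fin N)} (h : (l.map a).sum ≠ 0)
    (f : Fin N → ℝ) :
    (l.map fun k => f k * dwell a t l k).sum
      = t / (l.map a).sum * (l.map fun k => a k * f k).sum := by
  rw [← List.sum_map_mul_left]
  congr 1
  refine List.map_congr_left fun k _ => ?_
  rw [dwell]
  field_simp

theorem dwell_total (a : Fin N → ℝ) (t : ℝ) {l : List (Fin N)} (h : (l.map a).sum ≠ 0) :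
    (l.map (dwell a t l)).sum = t := by
  have := dwell_sum a t h fun _ => 1
  simp only [one_mul, mul_one] at this
  rw [show (l.map (dwell a t l)).sum = (l.map fun k => dwell a t l k).sum from rfl, this]
  field_simp

/-- The properties of a list of gates that make the evolution interrupted by them well behaved:
the gates are unitary and are listed in chronological order within `[s, T]`. -/
structure IsSchedule (s T : ℝ) (G : List (ℝ × Op N)) : Prop where
  unitary : ∀ p ∈ G, p.2ᴴ * p.2 = 1
  time_mem : ∀ p ∈ G, s ≤ p.1 ∧ p.1 ≤ T
  sorted : G.Pairwise fun p q => p.1 ≤ q.1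

theorem IsSchedule.tail {s T u : ℝ} {S : Op N} {G : List (ℝ × Op N)}
    (h : IsSchedule s T ((u, S) :: G)) : IsSchedule u T G where
  unitary p hp := h.unitary p (List.mem_cons_of_mem _ hp)
  time_mem p hp := ⟨(List.pairwise_cons.mp h.sorted).1 p hp,
    (h.time_mem p (List.mem_cons_of_mem _ hp)).2⟩
  sorted := (List.pairwise_cons.mp h.sorted).2

theorem gates_isSchedule (K : ONB N) (a : Fin N → ℝ) (t : ℝ) {xs ys : List (Fin N)}
    (hx : xs.Nodup) (hy : ys.Nodup) (hxa : ∀ k ∈ xs, 0 ≤ dwell a t xs k)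
    (hya : ∀ k ∈ ys, 0 ≤ dwell a t ys k) (hxs : (xs.map a).sum ≠ 0) (hys : (ys.map a).sum ≠ 0) :
    IsSchedule 0 t (gates K a t xs ys) where
  unitary p hp := by
    rw [gates, List.mem_merge] at hp
    rcases hp with hp | hp
    · exact swapGates_unitary K _ _ hx p hp
    · exact swapGates_unitary K _ _ hy p hp
  time_mem p hp := by
    rw [gates, List.mem_merge] at hp
    rcases hp with hp | hp
    · simpa [dwell_total a t hxs] using swapGates_time_mem K _ 0 hxa p hp
    · simpa [dwell_total a t hys] using swapGates_time_mem K _ 0 hya p hp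
  sorted := by
    classical
    refine (List.pairwise_merge (le := fun p q : ℝ × Op N => decide (p.1 ≤ q.1)) ?_ ?_ _ _
      ((swapGates_pairwise K _ 0 hxa).imp ?_) ((swapGates_pairwise K _ 0 hya).imp ?_)).imp ?_
    · intro p q r hpq hqr
      simp only [decide_eq_true_eq] at *
      exact hpq.trans hqr
    · intro p q
      simpa using le_total p.1 q.1
    all_goals simp

/-! ### The phase accumulated under the dephased Hamiltonian -/

/-- If the drift multiplies each basis vector by a phase, the protocol moves the first member `x` of
a chain along the chain, whatever other gates are interleaved that fix the chain. The phase has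
three contributions: the dwell times, a correction for the time `s - s₀` already spent on `x`, and
the time left after the last dwell. -/
theorem act_propagate_chain (K : ONB N) (τ h : Fin N → ℝ) {W : ℝ → ℝ → Op N}
    (hW : ∀ u v k, act (W u v) (K k)
      = Complex.exp (-(Complex.I * ((h k * (v - u) : ℝ) : ℂ))) • K k)
    (T : ℝ) {G₁ G₂ G : List (ℝ × Op N)} (hG : IsInterleaving G₁ G₂ G) (s s₀ : ℝ) (x : Fin N)
    (r : List (Fin N)) (hG₁ : swapGates K τ s₀ (x :: r) = G₁) (hr : (x :: r).Nodup)
    (hfix : ∀ p ∈ G₂, ∀ k ∈ x :: r, act p.2 (K k) = K k) :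
    act (propagate W T s G) (K x)
      = Complex.exp (-(Complex.I * ((((x :: r).map fun k => h k * τ k).sum + h x * (s₀ - s)
          + h ((x :: r).getLast (by simp)) * (T - s₀ - ((x :: r).map τ).sum) : ℝ) : ℂ)))
        • K ((x :: r).getLast (by simp)) := by
  induction hG generalizing s s₀ x r with
  | nil =>
    cases r with
    | nil =>
      rw [propagate, hW]
      congr 5
      simp
      ring
    | cons x' r => simp [swapGates] at hG₁
  | left p _ ih =>
    cases r with
    | nil => simp [swapGates] at hG₁
    | cons x' r =>
      rw [swapGates, List.cons.injEq] at hG₁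
      obtain ⟨rfl, hG₁⟩ := hG₁
      have hxx : x ≠ x' := fun h => by simp [h] at hr
      rw [propagate, act_mul, act_mul, hW, act_smul, act_smul, swapOp_basis K _ _ _ hxx,
        Equiv.swap_apply_left, ih _ _ x' r hG₁ hr.of_cons
          (fun p hp k hk => hfix p hp k (List.mem_cons_of_mem _ hk)), smul_smul, ← Complex.exp_add]
      congr 2
      rw [← neg_add, ← mul_add, ← Complex.ofReal_add]
      congr 3
      simp only [List.map_cons, List.sum_cons, List.getLast_cons_cons]
      ring
  | right p _ ih =>
    rw [propagate, act_mul, act_mul, hW, act_smul, act_smul, hfix p (by simp) x (by simp),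
      ih _ _ x r hG₁ hr fun p hp => hfix p (List.mem_cons_of_mem _ hp), smul_smul,
      ← Complex.exp_add]
    congr 2
    rw [← neg_add, ← mul_add, ← Complex.ofReal_add]
    congr 3
    ring

theorem act_idealDrift_basis (K : ONB N) {H : Op N} (hH : H.IsHermitian) (u v : ℝ) (k : Fin N) :
    act (idealDrift K H u v) (K k)
      = Complex.exp (-(Complex.I * (((⟪K k, act H (K k)⟫_ℂ).re * (v - u) : ℝ) : ℂ))) • K k := by
  have hre : ((⟪K k, act H (K k)⟫_ℂ).re : ℂ) = ⟪K k, act H (K k)⟫_ℂ := by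
    rw [← Complex.conj_eq_iff_re, inner_conj_symm, ← inner_act_conjTranspose, hH.eq]
  rw [idealDrift]
  refine act_exp_of_eigenvector ?_
  rw [act_smul_left, diagPart, act_diagonal_basis, smul_smul]
  congr 1
  push_cast
  rw [hre]
  ring

theorem act_idealProtocol_ghz (K : ONB N) (a : Fin N → ℝ) (t γ : ℝ) (hγ : γ ≠ 0) {H : Op N}
    (hH : H.IsHermitian) {x₀ y₀ : Fin N} {xs ys : List (Fin N)} (hx : (x₀ :: xs).Nodup)
    (hy : (y₀ :: ys).Nodup) (hxy : ∀ k ∈ x₀ :: xs, k ∉ y₀ :: ys)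
    (hxs : ((x₀ :: xs).map a).sum = γ) (hys : ((y₀ :: ys).map a).sum = -γ) (q : ℝ)
    (hq : ((x₀ :: xs).map fun k => a k * (⟪K k, act H (K k)⟫_ℂ).re).sum
      + ((y₀ :: ys).map fun k => a k * (⟪K k, act H (K k)⟫_ℂ).re).sum = q) (φ : ℝ) :
    ∃ c : ℂ, ‖c‖ = 1 ∧ act (idealProtocol K a t (x₀ :: xs) (y₀ :: ys) H) (ghz K x₀ y₀ φ)
      = c • ghz K ((x₀ :: xs).getLast (by simp)) ((y₀ :: ys).getLast (by simp))
          (φ + q * t / γ) := by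
  classical
  have hxs0 : ((x₀ :: xs).map a).sum ≠ 0 := by rwa [hxs]
  have hys0 : ((y₀ :: ys).map a).sum ≠ 0 := by rw [hys]; simpa using hγ
  have hI : IsInterleaving (swapGates K (dwell a t (x₀ :: xs)) 0 (x₀ :: xs))
      (swapGates K (dwell a t (y₀ :: ys)) 0 (y₀ :: ys)) (gates K a t (x₀ :: xs) (y₀ :: ys)) :=
    IsInterleaving.merge _ _ _
  set h : Fin N → ℝ := fun k => (⟪K k, act H (K k)⟫_ℂ).re with hh
  have h1 := act_propagate_chain K _ h (act_idealDrift_basis K hH) t hI 0 0 x₀ xs rfl hx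
    fun p hp k hk => swapGates_fixes K _ _ hy (hxy k hk) p hp
  have h2 := act_propagate_chain K _ h (act_idealDrift_basis K hH) t hI.symm 0 0 y₀ ys rfl hy
    fun p hp k hk => swapGates_fixes K _ _ hx (fun hk' => hxy k hk' hk) p hp
  rw [dwell_sum a t hxs0, dwell_total a t hxs0, hxs] at h1
  rw [dwell_sum a t hys0, dwell_total a t hys0, hys] at h2
  simp only [sub_self, sub_zero, mul_zero, add_zero] at h1 h2
  set X : ℝ := ((x₀ :: xs).map fun k => a k * h k).sum
  set Y : ℝ := ((y₀ :: ys).map fun k => a k * h k).sum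
  refine ⟨Complex.exp (-(Complex.I * ((t / γ * X : ℝ) : ℂ))), ?_, ?_⟩
  · rw [← mul_neg, ← Complex.ofReal_neg, mul_comm, Complex.norm_exp_ofReal_mul_I]
  · have key : Complex.exp (Complex.I * φ) * Complex.exp (-(Complex.I * ((t / -γ * Y : ℝ) : ℂ)))
        = Complex.exp (-(Complex.I * ((t / γ * X : ℝ) : ℂ)))
          * Complex.exp (Complex.I * ((φ + q * t / γ : ℝ) : ℂ)) := by
      have hγ' : (γ : ℂ) ≠ 0 := by exact_mod_cast hγ
      rw [← Complex.exp_add, ← Complex.exp_add, ← hq]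
      congr 1
      push_cast
      field_simp
      ring
    rw [idealProtocol, ghz, act_smul, act_add, act_smul, h1, h2, ghz]
    refine Eq.trans ?_ (smul_comm _ _ _)
    congr 1
    rw [smul_add, smul_smul, smul_smul, key]

/-! ### Estimates for exponentials and ordered products -/

theorem norm_one_le : ‖(1 : Op N)‖ ≤ 1 := norm_le_one_of_unitary (by simp)

theorem norm_pow_le_pow_norm (X : Op N) (n : ℕ) : ‖X ^ n‖ ≤ ‖X‖ ^ n := by
  rcases Nat.eq_zero_or_pos n with rfl | hn
  · simpa using norm_one_le
  · exact norm_pow_le' X hn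

theorem norm_exp_le (X : Op N) : ‖NormedSpace.exp X‖ ≤ Real.exp ‖X‖ := by
  have h1 := NormedSpace.exp_series_hasSum_exp' (𝕂 := ℂ) X
  have h2 := NormedSpace.exp_series_hasSum_exp' (𝕂 := ℝ) ‖X‖
  rw [← Real.exp_eq_exp_ℝ] at h2
  rw [← h1.tsum_eq]
  refine tsum_of_norm_bounded h2 fun n => ?_
  rw [norm_smul, norm_inv, Complex.norm_natCast, smul_eq_mul]
  gcongr
  exact norm_pow_le_pow_norm X n

theorem norm_exp_sub_one_sub_le (X : Op N) :
    ‖NormedSpace.exp X - 1 - X‖ ≤ ‖X‖ ^ 2 * Real.exp ‖X‖ := by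
  have h1 := (hasSum_nat_add_iff' 2).mpr (NormedSpace.exp_series_hasSum_exp' (𝕂 := ℂ) X)
  have h2 := (NormedSpace.exp_series_hasSum_exp' (𝕂 := ℝ) ‖X‖).mul_left (‖X‖ ^ 2)
  rw [← Real.exp_eq_exp_ℝ] at h2
  have h3 : NormedSpace.exp X - 1 - X = NormedSpace.exp X
      - ∑ i ∈ Finset.range 2, ((i.factorial : ℂ)⁻¹) • X ^ i := by
    simp [Finset.sum_range_succ, sub_sub]
  rw [h3, ← h1.tsum_eq]
  refine tsum_of_norm_bounded h2 fun n => ?_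
  rw [norm_smul, norm_inv, Complex.norm_natCast, smul_eq_mul]
  calc ((n + 2).factorial : ℝ)⁻¹ * ‖X ^ (n + 2)‖
      ≤ (n.factorial : ℝ)⁻¹ * ‖X‖ ^ (n + 2) := by
        gcongr
        · omega
        · exact norm_pow_le_pow_norm X _
    _ = ‖X‖ ^ 2 * ((n.factorial : ℝ)⁻¹ * ‖X‖ ^ n) := by ring

theorem reverse_prod_ofFn_succ {L : ℕ} (X : Fin (L + 1) → Op N) :
    (List.ofFn X).reverse.prod = (List.ofFn fun l : Fin L => X l.succ).reverse.prod * X 0 := by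
  rw [List.ofFn_succ, List.reverse_cons, List.prod_append, List.prod_singleton]

theorem norm_prod_ofFn_le {L : ℕ} (X : Fin L → Op N) (b : Fin L → ℝ) (hX : ∀ l, ‖X l‖ ≤ b l) :
    ‖(List.ofFn X).reverse.prod‖ ≤ ∏ l, b l := by
  induction L with
  | zero => simpa using norm_one_le
  | succ L ih =>
    rw [reverse_prod_ofFn_succ, Fin.prod_univ_succ, mul_comm (b 0)]
    have h := ih (fun l => X l.succ) (fun l => b l.succ) fun l => hX _
    exact (norm_mul_le _ _).trans
      (mul_le_mul h (hX 0) (norm_nonneg _) ((norm_nonneg _).trans h))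

/-- Telescoping estimate for ordered products of contractions. -/
theorem norm_prod_ofFn_sub_le {L : ℕ} (X Y : Fin L → Op N) (hX : ∀ l, ‖X l‖ ≤ 1)
    (hY : ∀ l, ‖Y l‖ ≤ 1) :
    ‖(List.ofFn X).reverse.prod - (List.ofFn Y).reverse.prod‖ ≤ ∑ l, ‖X l - Y l‖ := by
  induction L with
  | zero => simp
  | succ L ih =>
    rw [reverse_prod_ofFn_succ, reverse_prod_ofFn_succ, Fin.sum_univ_succ]
    set P := (List.ofFn fun l : Fin L => X l.succ).reverse.prod with hP
    set Q := (List.ofFn fun l : Fin L => Y l.succ).reverse.prod with hQ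
    have h1 : ‖P - Q‖ ≤ ∑ l : Fin L, ‖X l.succ - Y l.succ‖ :=
      ih (fun l => X l.succ) (fun l => Y l.succ) (fun l => hX _) (fun l => hY _)
    have h2 : ‖P‖ ≤ 1 := by
      simpa using norm_prod_ofFn_le (fun l : Fin L => X l.succ) (fun _ => 1) fun l => hX _
    calc ‖P * X 0 - Q * Y 0‖ = ‖P * (X 0 - Y 0) + (P - Q) * Y 0‖ := by
          congr 1
          noncomm_ring
      _ ≤ ‖P‖ * ‖X 0 - Y 0‖ + ‖P - Q‖ * ‖Y 0‖ :=
          (norm_add_le _ _).trans (add_le_add (norm_mul_le _ _) (norm_mul_le _ _))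
      _ ≤ 1 * ‖X 0 - Y 0‖ + (∑ l : Fin L, ‖X l.succ - Y l.succ‖) * 1 := by
          gcongr
          exact hY 0
      _ = _ := by ring

theorem prod_ofFn_exp {L : ℕ} (M : Op N) (c : Fin L → ℂ) :
    (List.ofFn fun l => NormedSpace.exp (c l • M)).reverse.prod
      = NormedSpace.exp ((∑ l, c l) • M) := by
  induction L with
  | zero => simp [NormedSpace.exp_zero]
  | succ L ih =>
    have hc : Commute ((∑ l : Fin L, c l.succ) • M) (c 0 • M) :=
      ((Commute.refl M).smul_left _).smul_right _
    rw [reverse_prod_ofFn_succ, ih fun l => c l.succ, Fin.sum_univ_succ, add_comm (c 0), add_smul,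
      Matrix.exp_add_of_commute _ _ hc]

/-- The mean of an ordered product of independent factors is the product of their means. -/
theorem average_prod_ofFn {L : ℕ} (X : Fin L → Fin N → Op N) :
    ((N : ℂ) ^ L)⁻¹ • ∑ s : Fin L → Fin N, (List.ofFn fun l => X l (s l)).reverse.prod
      = (List.ofFn fun l => (N : ℂ)⁻¹ • ∑ k, X l k).reverse.prod := by
  induction L with
  | zero => simp
  | succ L ih =>
    rw [reverse_prod_ofFn_succ, ← ih fun l => X l.succ,
      ← (Fin.consEquiv fun _ : Fin (L + 1) => Fin N).sum_comp, Fintype.sum_prod_type]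
    simp only [reverse_prod_ofFn_succ, Fin.consEquiv_apply, Fin.cons_zero, Fin.cons_succ]
    rw [smul_mul_smul_comm, Finset.sum_mul_sum, Finset.sum_comm, pow_succ, mul_inv]

/-! ### The step overlaps -/

theorem overlap_nonneg (t : ℝ) (L l : ℕ) (u v : ℝ) : 0 ≤ overlap t L l u v := le_max_left _ _

theorem overlap_le {t : ℝ} (ht : 0 ≤ t) (L l : ℕ) (u v : ℝ) : overlap t L l u v ≤ t / L := by
  have h : 0 ≤ t / L := by positivity
  refine max_le h ?_
  have h1 := min_le_right v (((l : ℝ) + 1) * (t / L))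
  have h2 := le_max_right u ((l : ℝ) * (t / L))
  linarith

/-- The overlap is the increment, over the step, of the projection of time onto `[u, v]`. -/
theorem overlap_eq_sub {t : ℝ} (ht : 0 ≤ t) (L l : ℕ) {u v : ℝ} (huv : u ≤ v) :
    overlap t L l u v
      = max u (min v (((l + 1 : ℕ) : ℝ) * (t / L))) - max u (min v ((l : ℝ) * (t / L))) := by
  have h : 0 ≤ t / L := by positivity
  have hab : (l : ℝ) * (t / L) ≤ ((l : ℝ) + 1) * (t / L) := by nlinarith
  rw [overlap]
  push_cast
  generalize (l : ℝ) * (t / L) = a at *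
  generalize ((l : ℝ) + 1) * (t / L) = b at *
  simp only [max_def, min_def]
  split_ifs <;> linarith

/-- The overlaps of the steps with an interval add up to its length. -/
theorem sum_overlap {t : ℝ} (ht : 0 ≤ t) {L : ℕ} (hL : L ≠ 0) {u v : ℝ} (hu : 0 ≤ u)
    (huv : u ≤ v) (hv : v ≤ t) : ∑ l : Fin L, overlap t L l u v = v - u := by
  rw [Fin.sum_univ_eq_sum_range (fun l => overlap t L l u v),
    Finset.sum_congr rfl fun l _ => overlap_eq_sub ht L l huv,
    Finset.sum_range_sub fun l : ℕ => max u (min v ((l : ℝ) * (t / L)))]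
  have hL' : (L : ℝ) ≠ 0 := by exact_mod_cast hL
  rw [mul_div_cancel₀ _ hL', min_eq_left hv, max_eq_right huv, Nat.cast_zero, zero_mul,
    min_eq_right (hu.trans huv), max_eq_left hu]

theorem sum_overlap_le {t : ℝ} (ht : 0 ≤ t) (L : ℕ) (u v : ℝ) :
    ∑ l : Fin L, overlap t L l u v ≤ t := by
  refine (Finset.sum_le_sum fun (l : Fin L) _ => overlap_le ht L (l : ℕ) u v).trans ?_
  rw [Finset.sum_const, Finset.card_univ, Fintype.card_fin, nsmul_eq_mul]
  rcases Nat.eq_zero_or_pos L with rfl | hL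
  · simpa using ht
  · field_simp
    exact le_rfl

/-! ### Convergence of a single segment -/

theorem norm_conj_clock_le (K : ONB N) (s : Fin N) (X : Op N) :
    ‖(clock K s)ᴴ * X * clock K s‖ ≤ ‖X‖ := by
  have h := norm_le_one_of_unitary (clock_unitary K s)
  have h' : ‖(clock K s)ᴴ‖ ≤ 1 := by rwa [Matrix.l2_opNorm_conjTranspose]
  calc ‖(clock K s)ᴴ * X * clock K s‖ ≤ ‖(clock K s)ᴴ‖ * ‖X‖ * ‖clock K s‖ :=
        (norm_mul_le _ _).trans (by gcongr; exact norm_mul_le _ _)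
    _ ≤ 1 * ‖X‖ * 1 := by gcongr
    _ = ‖X‖ := by ring

theorem norm_average_le (hN : N ≠ 0) (X : Fin N → Op N) {b : ℝ} (hX : ∀ k, ‖X k‖ ≤ b) :
    ‖(N : ℂ)⁻¹ • ∑ k, X k‖ ≤ b := by
  have hN' : (N : ℝ) ≠ 0 := by exact_mod_cast hN
  rw [norm_smul, norm_inv, Complex.norm_natCast]
  calc (N : ℝ)⁻¹ * ‖∑ k, X k‖ ≤ (N : ℝ)⁻¹ * ∑ _k : Fin N, b := by
        gcongr
        exact norm_sum_le_of_le _ fun k _ => hX k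
    _ = b := by
        rw [Finset.sum_const, Finset.card_univ, Fintype.card_fin, nsmul_eq_mul]
        field_simp

theorem norm_diagPart_le (hN : N ≠ 0) (K : ONB N) (H : Op N) : ‖diagPart K H‖ ≤ ‖H‖ := by
  rw [← average_clock]
  exact norm_average_le hN _ fun s => norm_conj_clock_le K s H

theorem diagPart_isHermitian (K : ONB N) {H : Op N} (hH : H.IsHermitian) :
    (diagPart K H).IsHermitian := by
  rw [← average_clock, Matrix.IsHermitian, Matrix.conjTranspose_smul, Matrix.conjTranspose_sum]
  congr 1
  · simp
  · refine Finset.sum_congr rfl fun s _ => ?_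
    simp [Matrix.conjTranspose_mul, hH.eq, Matrix.mul_assoc]

theorem idealDrift_unitary (K : ONB N) {H : Op N} (hH : H.IsHermitian) (u v : ℝ) :
    (idealDrift K H u v)ᴴ * idealDrift K H u v = 1 :=
  exp_unitary (diagPart_isHermitian K hH) _

theorem qdriftDrift_unitary (K : ONB N) {H : Op N} (hH : H.IsHermitian) (t : ℝ) (L : ℕ)
    (s : Fin L → Fin N) (u v : ℝ) :
    (qdriftDrift K H t L s u v)ᴴ * qdriftDrift K H t L s u v = 1 := by
  refine unitary_list_prod fun V hV => ?_
  rw [List.mem_reverse, List.mem_ofFn] at hV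
  obtain ⟨l, rfl⟩ := hV
  have h : (clock K (s l))ᴴᴴ * (clock K (s l))ᴴ = 1 := by
    rw [Matrix.conjTranspose_conjTranspose]
    exact mul_eq_one_comm.mp (clock_unitary K (s l))
  exact unitary_mul (unitary_mul h (exp_unitary hH _)) (clock_unitary K _)

/-- One randomized step agrees on average with the dephased step up to second order. -/
theorem norm_average_step_sub_le (hN : N ≠ 0) (K : ONB N) (H : Op N) (c : ℂ) :
    ‖(N : ℂ)⁻¹ • ∑ k, (clock K k)ᴴ * NormedSpace.exp (c • H) * clock K k
      - NormedSpace.exp (c • diagPart K H)‖ ≤ 2 * ((‖c‖ * ‖H‖) ^ 2 * Real.exp (‖c‖ * ‖H‖)) := by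
  have hN' : (N : ℂ) ≠ 0 := by exact_mod_cast hN
  have h1 : (N : ℂ)⁻¹ • ∑ k, (clock K k)ᴴ * NormedSpace.exp (c • H) * clock K k
      = 1 + c • diagPart K H + (N : ℂ)⁻¹ • ∑ k,
        (clock K k)ᴴ * (NormedSpace.exp (c • H) - 1 - c • H) * clock K k := by
    have h2 : ∀ k, (clock K k)ᴴ * (NormedSpace.exp (c • H) - 1 - c • H) * clock K k
        = (clock K k)ᴴ * NormedSpace.exp (c • H) * clock K k - 1
          - c • ((clock K k)ᴴ * H * clock K k) := by
      intro k
      simp only [mul_sub, sub_mul, mul_one, clock_unitary, Matrix.mul_smul, Matrix.smul_mul]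
    simp only [h2, Finset.sum_sub_distrib, smul_sub, ← Finset.smul_sum]
    rw [smul_comm _ c, average_clock K H, Finset.sum_const, Finset.card_univ, Fintype.card_fin,
      ← Nat.cast_smul_eq_nsmul ℂ, smul_smul, inv_mul_cancel₀ hN', one_smul]
    abel
  have h3 : ‖(N : ℂ)⁻¹ • ∑ k,
      (clock K k)ᴴ * (NormedSpace.exp (c • H) - 1 - c • H) * clock K k‖
      ≤ (‖c‖ * ‖H‖) ^ 2 * Real.exp (‖c‖ * ‖H‖) := by
    refine norm_average_le hN _ fun k => (norm_conj_clock_le K k _).trans ?_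
    rw [← norm_smul]
    exact norm_exp_sub_one_sub_le _
  have h4 : ‖NormedSpace.exp (c • diagPart K H) - 1 - c • diagPart K H‖
      ≤ (‖c‖ * ‖H‖) ^ 2 * Real.exp (‖c‖ * ‖H‖) := by
    refine (norm_exp_sub_one_sub_le _).trans ?_
    have : ‖c • diagPart K H‖ ≤ ‖c‖ * ‖H‖ := by
      rw [norm_smul]
      gcongr
      exact norm_diagPart_le hN K H
    gcongr
  have h5 : ∀ X R E : Op N, 1 + X + R - E = R - (E - 1 - X) := fun X R E => by abel
  rw [h1, h5]
  exact (norm_sub_le _ _).trans (by linarith)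

theorem norm_average_qdriftDrift_sub_le (hN : N ≠ 0) (K : ONB N) {H : Op N}
    (hH : H.IsHermitian) {B : ℝ} (hB : ‖H‖ ≤ B) {t : ℝ} (ht : 0 ≤ t) {L : ℕ} (hL : L ≠ 0)
    {u v : ℝ} (hu : 0 ≤ u) (huv : u ≤ v) (hv : v ≤ t) :
    ‖((N : ℂ) ^ L)⁻¹ • ∑ s : Fin L → Fin N, qdriftDrift K H t L s u v - idealDrift K H u v‖
      ≤ 2 * t ^ 2 * B ^ 2 * Real.exp (t * B) / L := by
  have hB0 : 0 ≤ B := (norm_nonneg H).trans hB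
  -- split the dephased evolution into the same steps; each step contributes a second-order error,
  -- and the step lengths are at most `t / L` and add up to at most `t`
  set c : Fin L → ℂ := fun l => -(Complex.I * (overlap t L (l : ℕ) u v : ℂ)) with hc
  have hcn : ∀ l, ‖c l‖ = overlap t L l u v := fun l => by
    rw [hc, norm_neg, norm_mul, Complex.norm_I, one_mul, Complex.norm_real, Real.norm_eq_abs,
      abs_of_nonneg (overlap_nonneg _ _ _ _ _)]
  have hideal : idealDrift K H u v
      = (List.ofFn fun l => NormedSpace.exp (c l • diagPart K H)).reverse.prod := by
    rw [prod_ofFn_exp, idealDrift, hc, Finset.sum_neg_distrib, ← Finset.mul_sum,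
      ← Complex.ofReal_sum, sum_overlap ht hL hu huv hv]
  have hmean : ((N : ℂ) ^ L)⁻¹ • ∑ s : Fin L → Fin N, qdriftDrift K H t L s u v
      = (List.ofFn fun l => (N : ℂ)⁻¹ • ∑ k,
          (clock K k)ᴴ * NormedSpace.exp (c l • H) * clock K k).reverse.prod :=
    average_prod_ofFn fun l k => (clock K k)ᴴ * NormedSpace.exp (c l • H) * clock K k
  rw [hideal, hmean]
  refine (norm_prod_ofFn_sub_le _ _ (fun l => ?_) fun l => ?_).trans ?_
  · exact norm_average_le hN _ fun k => (norm_conj_clock_le K k _).trans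
      (norm_le_one_of_unitary (exp_unitary hH _))
  · exact norm_le_one_of_unitary (exp_unitary (diagPart_isHermitian K hH) _)
  · have hstep : ∀ l : Fin L, ‖(N : ℂ)⁻¹ • ∑ k,
          (clock K k)ᴴ * NormedSpace.exp (c l • H) * clock K k
          - NormedSpace.exp (c l • diagPart K H)‖
        ≤ overlap t L l u v * (2 * (t / L) * B ^ 2 * Real.exp (t * B)) := by
      intro l
      refine (norm_average_step_sub_le hN K H (c l)).trans ?_
      rw [hcn]
      have h0 := overlap_nonneg t L l u v
      have h1 := overlap_le ht L l u v
      have h2 : overlap t L l u v ≤ t :=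
        (Finset.single_le_sum (f := fun l : Fin L => overlap t L l u v)
          (fun l _ => overlap_nonneg t L l u v) (Finset.mem_univ l)).trans (sum_overlap_le ht L u v)
      generalize overlap t L l u v = o at *
      calc 2 * ((o * ‖H‖) ^ 2 * Real.exp (o * ‖H‖))
          = o * (2 * o * ‖H‖ ^ 2 * Real.exp (o * ‖H‖)) := by ring
        _ ≤ _ := by gcongr
    refine (Finset.sum_le_sum fun l _ => hstep l).trans ?_
    rw [← Finset.sum_mul]
    calc (∑ l : Fin L, overlap t L l u v) * (2 * (t / L) * B ^ 2 * Real.exp (t * B))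
        ≤ t * (2 * (t / L) * B ^ 2 * Real.exp (t * B)) := by
          gcongr
          exact sum_overlap_le ht L u v
      _ = _ := by ring

/-! ### Convergence of the randomized protocol in mean -/

/-- The expectation of `f` under independent uniform random choices `s 0, …, s (L - 1)`. -/
def mean {L : ℕ} (f : (Fin L → Fin N) → ℝ) : ℝ := ((N : ℝ) ^ L)⁻¹ * ∑ s, f s

theorem mean_mono {L : ℕ} {f f' : (Fin L → Fin N) → ℝ} (h : ∀ s, f s ≤ f' s) :
    mean f ≤ mean f' := by
  unfold mean
  gcongr
  exact h _

theorem mean_add {L : ℕ} (f f' : (Fin L → Fin N) → ℝ) :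
    mean (fun s => f s + f' s) = mean f + mean f' := by
  rw [mean, mean, mean, Finset.sum_add_distrib, mul_add]

theorem mean_sub {L : ℕ} (f f' : (Fin L → Fin N) → ℝ) :
    mean (fun s => f s - f' s) = mean f - mean f' := by
  rw [mean, mean, mean, Finset.sum_sub_distrib, mul_sub]

theorem mean_const_mul {L : ℕ} (c : ℝ) (f : (Fin L → Fin N) → ℝ) :
    mean (fun s => c * f s) = c * mean f := by
  rw [mean, mean, ← Finset.mul_sum]
  ring

theorem mean_sum {L : ℕ} {ι : Type*} (I : Finset ι) (f : ι → (Fin L → Fin N) → ℝ) :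
    mean (fun s => ∑ i ∈ I, f i s) = ∑ i ∈ I, mean (f i) := by
  simp only [mean]
  rw [Finset.sum_comm, Finset.mul_sum]

theorem mean_const (hN : N ≠ 0) {L : ℕ} (c : ℝ) : mean (fun _ : Fin L → Fin N => c) = c := by
  have hN' : (N : ℝ) ^ L ≠ 0 := pow_ne_zero _ (by exact_mod_cast hN)
  rw [mean, Finset.sum_const, Finset.card_univ, Fintype.card_fun, Fintype.card_fin,
    Fintype.card_fin, nsmul_eq_mul, Nat.cast_pow, inv_mul_cancel_left₀ hN']

theorem abs_mean_le {L : ℕ} (f : (Fin L → Fin N) → ℝ) : |mean f| ≤ mean fun s => |f s| := by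
  rw [mean, mean, abs_mul, abs_of_nonneg (by positivity : (0 : ℝ) ≤ ((N : ℝ) ^ L)⁻¹)]
  gcongr
  exact Finset.abs_sum_le_sum_abs _ _

/-- Jensen's inequality for the square. -/
theorem mean_le_sqrt (hN : N ≠ 0) {L : ℕ} {f : (Fin L → Fin N) → ℝ} {b : ℝ}
    (hb : mean (fun s => f s ^ 2) ≤ b) : mean f ≤ Real.sqrt b := by
  refine Real.le_sqrt_of_sq_le (le_trans ?_ hb)
  have h : 0 ≤ mean (fun s => (f s - mean f) ^ 2) := by
    unfold mean
    positivity
  have h2 : mean (fun s => (f s - mean f) ^ 2) = mean (fun s => f s ^ 2) - mean f ^ 2 := by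
    have h3 : ∀ s, (f s - mean f) ^ 2 = f s ^ 2 - (2 * mean f) * f s + mean f ^ 2 :=
      fun s => by ring
    simp only [h3]
    rw [mean_add, mean_sub, mean_const_mul, mean_const hN]
    ring
  linarith

/-- The spectral norm is at most the Frobenius norm. -/
theorem norm_sq_le_sum (K : ONB N) (M : Op N) : ‖M‖ ^ 2 ≤ ∑ k, ‖act M (K k)‖ ^ 2 := by
  have h : ‖M‖ ≤ Real.sqrt (∑ k, ‖act M (K k)‖ ^ 2) := by
    rw [Matrix.cstar_norm_def]
    refine ContinuousLinearMap.opNorm_le_bound _ (Real.sqrt_nonneg _) fun ψ => ?_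
    change ‖act M ψ‖ ≤ _
    calc ‖act M ψ‖ = ‖∑ k, ⟪K k, ψ⟫_ℂ • act M (K k)‖ := by
          conv_lhs => rw [← K.sum_repr' ψ]
          simp only [act, map_sum, map_smul]
      _ ≤ ∑ k, ‖⟪K k, ψ⟫_ℂ‖ * ‖act M (K k)‖ :=
          norm_sum_le_of_le _ fun k _ => (norm_smul _ _).le
      _ ≤ Real.sqrt (∑ k, ‖⟪K k, ψ⟫_ℂ‖ ^ 2) * Real.sqrt (∑ k, ‖act M (K k)‖ ^ 2) :=
          Real.sum_mul_le_sqrt_mul_sqrt _ _ _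
      _ = _ := by
          rw [K.sum_sq_norm_inner_right, Real.sqrt_sq (norm_nonneg _), mul_comm]
  calc ‖M‖ ^ 2 ≤ Real.sqrt (∑ k, ‖act M (K k)‖ ^ 2) ^ 2 := by gcongr
    _ = _ := Real.sq_sqrt (by positivity)

/-- For unitaries, convergence of the average operator implies convergence in mean square:
the second moments are all equal to one, so only the first moment matters. -/
theorem mean_norm_sq_sub_le {L : ℕ} (hN : N ≠ 0) {D : Op N} {V : (Fin L → Fin N) → Op N}
    (hD : Dᴴ * D = 1) (hV : ∀ s, (V s)ᴴ * V s = 1) {ε : ℝ}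
    (hε : ‖((N : ℂ) ^ L)⁻¹ • ∑ s, V s - D‖ ≤ ε) :
    mean (fun s => ‖V s - D‖ ^ 2) ≤ 2 * N * ε := by
  let K : ONB N := EuclideanSpace.basisFun (Fin N) ℂ
  have hk : ∀ k, mean (fun s => ‖act (V s - D) (K k)‖ ^ 2) ≤ 2 * ε := by
    intro k
    set ψ := K k with hψ
    have hψ1 : ‖ψ‖ = 1 := K.orthonormal.1 k
    have h1 : ∀ s, ‖act (V s - D) ψ‖ ^ 2 = 2 - 2 * (⟪act D ψ, act (V s) ψ⟫_ℂ).re := by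
      intro s
      rw [act_sub_left, norm_sub_rev, norm_sub_sq (𝕜 := ℂ), norm_act_of_unitary hD,
        norm_act_of_unitary (hV s), hψ1, RCLike.re_to_complex]
      ring
    have h2 : mean (fun s => (⟪act D ψ, act (V s) ψ⟫_ℂ).re)
        = (⟪act D ψ, act (((N : ℂ) ^ L)⁻¹ • ∑ s, V s) ψ⟫_ℂ).re := by
      have h3 : ((N : ℂ) ^ L)⁻¹ = ((((N : ℝ) ^ L)⁻¹ : ℝ) : ℂ) := by push_cast; rfl
      rw [act_smul_left, act_sum_left, inner_smul_right, inner_sum, h3, Complex.re_ofReal_mul,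
        Complex.re_sum, mean]
    have h4 : (⟪act D ψ, act D ψ⟫_ℂ).re = 1 := by
      rw [inner_self_eq_norm_sq_to_K, norm_act_of_unitary hD, hψ1]
      simp
    simp only [h1]
    rw [mean_sub, mean_const hN, mean_const_mul, h2]
    have h5 : (⟪act D ψ, act (D - ((N : ℂ) ^ L)⁻¹ • ∑ s, V s) ψ⟫_ℂ).re ≤ ε := by
      refine (Complex.re_le_norm _).trans ((norm_inner_le_norm _ _).trans ?_)
      rw [norm_act_of_unitary hD, hψ1, one_mul]
      refine (norm_act_le _ _).trans ?_
      rwa [hψ1, mul_one, norm_sub_rev]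
    rw [act_sub_left, inner_sub_right, Complex.sub_re, h4] at h5
    linarith
  calc mean (fun s => ‖V s - D‖ ^ 2)
      ≤ mean (fun s => ∑ k, ‖act (V s - D) (K k)‖ ^ 2) := mean_mono fun s => norm_sq_le_sum K _
    _ = ∑ k, mean (fun s => ‖act (V s - D) (K k)‖ ^ 2) := mean_sum _ _
    _ ≤ ∑ _k : Fin N, 2 * ε := Finset.sum_le_sum fun k _ => hk k
    _ = 2 * N * ε := by
        rw [Finset.sum_const, Finset.card_univ, Fintype.card_fin, nsmul_eq_mul]
        ring

/-- A bound on the mean deviation of one segment of the randomized evolution with `L` steps from the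
dephased one, for Hamiltonians of spectral norm at most `B` and a total time `t`. -/
def segmentError (N : ℕ) (t B : ℝ) (L : ℕ) : ℝ :=
  Real.sqrt (2 * N * (2 * t ^ 2 * B ^ 2 * Real.exp (t * B) / L))

theorem tendsto_segmentError (N : ℕ) (t B : ℝ) :
    Tendsto (segmentError N t B) atTop (𝓝 0) := by
  have h := ((tendsto_const_div_atTop_nhds_zero_nat
    (2 * t ^ 2 * B ^ 2 * Real.exp (t * B))).const_mul (2 * (N : ℝ))).sqrt
  rwa [mul_zero, Real.sqrt_zero] at h

theorem mean_norm_segment_sub_le (hN : N ≠ 0) (K : ONB N) {H : Op N}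
    (hH : H.IsHermitian) {B : ℝ} (hB : ‖H‖ ≤ B) {t : ℝ} (ht : 0 ≤ t) {L : ℕ} (hL : L ≠ 0)
    {u v : ℝ} (hu : 0 ≤ u) (huv : u ≤ v) (hv : v ≤ t) :
    mean (fun s : Fin L → Fin N => ‖qdriftDrift K H t L s u v - idealDrift K H u v‖)
      ≤ segmentError N t B L :=
  mean_le_sqrt hN (mean_norm_sq_sub_le hN (idealDrift_unitary K hH u v)
    (fun s => qdriftDrift_unitary K hH t L s u v)
    (norm_average_qdriftDrift_sub_le hN K hH hB ht hL hu huv hv))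

theorem propagate_unitary {W : ℝ → ℝ → Op N} (hW : ∀ u v, (W u v)ᴴ * W u v = 1) (T s : ℝ)
    {G : List (ℝ × Op N)} (hG : ∀ p ∈ G, p.2ᴴ * p.2 = 1) :
    (propagate W T s G)ᴴ * propagate W T s G = 1 := by
  induction G generalizing s with
  | nil => exact hW s T
  | cons p G ih =>
    exact unitary_mul (unitary_mul (ih _ fun q hq => hG q (List.mem_cons_of_mem _ hq))
      (hG p (by simp))) (hW _ _)

/-- The deviations of the segments add up. -/
theorem mean_norm_propagate_sub_le (hN : N ≠ 0) (K : ONB N) {H : Op N}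
    (hH : H.IsHermitian) {B : ℝ} (hB : ‖H‖ ≤ B) {t : ℝ} (ht : 0 ≤ t) {L : ℕ} (hL : L ≠ 0)
    {G : List (ℝ × Op N)} {s₀ : ℝ} (hs₀ : 0 ≤ s₀) (hs₀t : s₀ ≤ t) (hG : IsSchedule s₀ t G) :
    mean (fun s : Fin L → Fin N => ‖propagate (qdriftDrift K H t L s) t s₀ G
        - propagate (idealDrift K H) t s₀ G‖)
      ≤ (G.length + 1) * segmentError N t B L := by
  induction G generalizing s₀ with
  | nil =>
    simpa [propagate] using mean_norm_segment_sub_le hN K hH hB ht hL hs₀ hs₀t le_rfl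
  | cons p G ih =>
    obtain ⟨u, S⟩ := p
    have hu := hG.time_mem (u, S) (by simp)
    have h1 := ih (hs₀.trans hu.1) hu.2 hG.tail
    have h2 := mean_norm_segment_sub_le hN K hH hB ht hL hs₀ hu.1 hu.2
    refine (mean_mono fun s => ?_).trans ((mean_add _ _).trans_le
      ((add_le_add h1 h2).trans (le_of_eq ?_)))
    · simp only [propagate]
      set P := propagate (qdriftDrift K H t L s) t u G with hP
      set Q := propagate (idealDrift K H) t u G
      set W := qdriftDrift K H t L s s₀ u with hW
      set D := idealDrift K H s₀ u
      have hPS : ‖P * S‖ ≤ 1 := norm_le_one_of_unitary (unitary_mul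
        (propagate_unitary (qdriftDrift_unitary K hH t L s) t u hG.tail.unitary)
        (hG.unitary (u, S) (by simp)))
      have hSD : ‖S * D‖ ≤ 1 := norm_le_one_of_unitary
        (unitary_mul (hG.unitary (u, S) (by simp)) (idealDrift_unitary K hH _ _))
      -- replace the later segments first, then the earliest one; the other factors are contractions
      calc ‖P * S * W - Q * S * D‖ = ‖(P - Q) * (S * D) + (P * S) * (W - D)‖ := by
            congr 1
            noncomm_ring
        _ ≤ ‖P - Q‖ * ‖S * D‖ + ‖P * S‖ * ‖W - D‖ :=
            (norm_add_le _ _).trans (add_le_add (norm_mul_le _ _) (norm_mul_le _ _))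
        _ ≤ ‖P - Q‖ * 1 + 1 * ‖W - D‖ := by gcongr
        _ = _ := by ring
    · push_cast [List.length_cons]
      ring

/-- Markov's inequality for the uniform distribution of the random choices. -/
theorem uniformOn_le_mean (hN : N ≠ 0) {L : ℕ} {f : (Fin L → Fin N) → ℝ} (hf : ∀ s, 0 ≤ f s)
    {ε : ℝ} (hε : 0 < ε) :
    ProbabilityTheory.uniformOn (Set.univ : Set (Fin L → Fin N)) {s | ε ≤ f s}
      ≤ ENNReal.ofReal (mean f / ε) := by
  classical
  have hN' : (0 : ℝ) < (N : ℝ) ^ L := pow_pos (by exact_mod_cast Nat.pos_of_ne_zero hN) _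
  rw [ProbabilityTheory.uniformOn_univ]
  have h1 : {s | ε ≤ f s} = ((Finset.univ.filter fun s => ε ≤ f s : Finset _) : Set _) := by
    simp
  rw [h1, Measure.count_apply_finset, Fintype.card_fun, Fintype.card_fin, Fintype.card_fin]
  have h2 : ((Finset.univ.filter fun s => ε ≤ f s).card : ℝ) * ε ≤ ∑ s, f s := by
    calc ((Finset.univ.filter fun s => ε ≤ f s).card : ℝ) * ε
        = ∑ s with ε ≤ f s, ε := by rw [Finset.sum_const, nsmul_eq_mul]
      _ ≤ ∑ s with ε ≤ f s, f s := Finset.sum_le_sum fun s hs => (Finset.mem_filter.mp hs).2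
      _ ≤ ∑ s, f s := Finset.sum_le_sum_of_subset_of_nonneg (Finset.filter_subset _ _)
          fun s _ _ => hf s
  rw [← ENNReal.ofReal_natCast, ← ENNReal.ofReal_natCast, Nat.cast_pow,
    ← ENNReal.ofReal_div_of_pos hN']
  refine ENNReal.ofReal_le_ofReal ?_
  rw [mean, le_div_iff₀ hε, div_mul_eq_mul_div, div_eq_inv_mul]
  gcongr

/-! ### Moments of the measurement outcome -/

/-- The expectation value of the observable `O` in the state `ψ`. -/
def expectation (O : Op N) (ψ : Ket N) : ℝ := (⟪ψ, act O ψ⟫_ℂ).re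

theorem expectation_sq {O : Op N} (hO : O.IsHermitian) (ψ : Ket N) :
    expectation (O * O) ψ = ‖act O ψ‖ ^ 2 := by
  rw [expectation, act_mul, ← inner_act_conjTranspose, hO.eq, inner_self_eq_norm_sq_to_K]
  norm_cast

theorem expectation_smul {c : ℂ} (hc : ‖c‖ = 1) (O : Op N) (ψ : Ket N) :
    expectation O (c • ψ) = expectation O ψ := by
  rw [expectation, act_smul, inner_smul_left, inner_smul_right, ← mul_assoc, RCLike.conj_mul, hc,
    expectation]
  simp

theorem abs_expectation_sub_le (O : Op N) {ψ χ : Ket N} (hψ : ‖ψ‖ ≤ 1) (hχ : ‖χ‖ ≤ 1) :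
    |expectation O ψ - expectation O χ| ≤ 2 * ‖O‖ * ‖ψ - χ‖ := by
  have h : ⟪ψ, act O ψ⟫_ℂ - ⟪χ, act O χ⟫_ℂ
      = ⟪ψ, act O (ψ - χ)⟫_ℂ + ⟪ψ - χ, act O χ⟫_ℂ := by
    rw [act_sub, inner_sub_right, inner_sub_left]
    ring
  rw [expectation, expectation, ← Complex.sub_re, h]
  refine (Complex.abs_re_le_norm _).trans ((norm_add_le _ _).trans ?_)
  have h1 : ‖⟪ψ, act O (ψ - χ)⟫_ℂ‖ ≤ 1 * (‖O‖ * ‖ψ - χ‖) :=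
    (norm_inner_le_norm _ _).trans
      (mul_le_mul hψ (norm_act_le _ _) (norm_nonneg _) zero_le_one)
  have h2 : ‖⟪ψ - χ, act O χ⟫_ℂ‖ ≤ ‖ψ - χ‖ * (‖O‖ * 1) :=
    (norm_inner_le_norm _ _).trans (mul_le_mul_of_nonneg_left
      ((norm_act_le _ _).trans (by gcongr)) (norm_nonneg _))
  linarith

theorem integrable_bornLaw (O : Op N) (hO : O.IsHermitian) (ψ : Ket N) (F : ℝ → ℝ) :
    Integrable F (bornLaw O hO ψ) := by
  rw [bornLaw, integrable_finsetSum_measure]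
  exact fun i _ => (integrable_dirac (by simp)).smul_measure ENNReal.ofReal_ne_top

theorem integral_bornLaw (O : Op N) (hO : O.IsHermitian) (ψ : Ket N) (F : ℝ → ℝ) :
    ∫ o, F o ∂(bornLaw O hO ψ)
      = ∑ i, ‖⟪hO.eigenvectorBasis i, ψ⟫_ℂ‖ ^ 2 * F (hO.eigenvalues i) := by
  rw [bornLaw, integral_finsetSum_measure fun i _ =>
    (integrable_dirac (by simp)).smul_measure ENNReal.ofReal_ne_top]
  refine Finset.sum_congr rfl fun i _ => ?_
  rw [integral_smul_measure, integral_dirac, ENNReal.toReal_ofReal (by positivity), smul_eq_mul]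

theorem bornLaw_univ (O : Op N) (hO : O.IsHermitian) {ψ : Ket N} (hψ : ‖ψ‖ = 1) :
    bornLaw O hO ψ Set.univ = 1 := by
  rw [bornLaw, Measure.finsetSum_apply]
  simp only [Measure.smul_apply, measure_univ, smul_eq_mul, mul_one]
  rw [← ENNReal.ofReal_sum_of_nonneg fun i _ => by positivity,
    hO.eigenvectorBasis.sum_sq_norm_inner_right, hψ]
  simp

theorem act_eigenvectorBasis {O : Op N} (hO : O.IsHermitian) (i : Fin N) :
    act O (hO.eigenvectorBasis i) = (hO.eigenvalues i : ℂ) • hO.eigenvectorBasis i := by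
  have := hO.mulVec_eigenvectorBasis i
  ext j
  simpa [act, Matrix.toLpLin_apply] using congrFun this j

theorem integral_id_bornLaw (O : Op N) (hO : O.IsHermitian) (ψ : Ket N) :
    ∫ o, o ∂(bornLaw O hO ψ) = expectation O ψ := by
  rw [integral_bornLaw O hO ψ fun o => o, expectation,
    ← hO.eigenvectorBasis.sum_inner_mul_inner ψ (act O ψ), Complex.re_sum]
  refine Finset.sum_congr rfl fun i _ => ?_
  rw [← inner_act_conjTranspose, hO.eq, act_eigenvectorBasis, inner_smul_left, Complex.conj_ofReal,
    mul_left_comm, Complex.re_ofReal_mul, ← inner_conj_symm ψ, RCLike.conj_mul, mul_comm]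
  norm_cast

theorem integral_sq_bornLaw (O : Op N) (hO : O.IsHermitian) (ψ : Ket N) :
    ∫ o, o ^ 2 ∂(bornLaw O hO ψ) = expectation (O * O) ψ := by
  rw [integral_bornLaw O hO ψ fun o => o ^ 2, expectation_sq hO,
    ← hO.eigenvectorBasis.sum_sq_norm_inner_right]
  refine Finset.sum_congr rfl fun i _ => ?_
  conv_rhs => rw [← inner_act_conjTranspose, hO.eq, act_eigenvectorBasis, inner_smul_left,
    Complex.conj_ofReal, norm_mul, mul_pow, Complex.norm_real, Real.norm_eq_abs, sq_abs, mul_comm]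

theorem integral_qdriftLaw (K : ONB N) (a : Fin N → ℝ) (t : ℝ) (x₀ : Fin N) (xs : List (Fin N))
    (y₀ : Fin N) (ys : List (Fin N)) (φ : ℝ) (H : Op N) (L : ℕ) (hN : N ≠ 0) (F : ℝ → ℝ) :
    Integrable F (qdriftLaw K a t x₀ xs y₀ ys φ H L) ∧
    ∫ o, F o ∂(qdriftLaw K a t x₀ xs y₀ ys φ H L)
      = mean fun s : Fin L → Fin N => ∫ o, F o ∂(bornLaw _ (readout_isHermitian K
          ((x₀ :: xs).getLast (by simp)) ((y₀ :: ys).getLast (by simp)))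
          (act (qdriftProtocol K a t (x₀ :: xs) (y₀ :: ys) H L s) (ghz K x₀ y₀ φ))) := by
  have hw : ((N : ENNReal) ^ L)⁻¹ ≠ ⊤ :=
    ENNReal.inv_ne_top.mpr (pow_ne_zero _ (by exact_mod_cast hN))
  constructor
  · rw [qdriftLaw, integrable_finsetSum_measure]
    exact fun s _ => (integrable_bornLaw _ _ _ F).smul_measure hw
  · rw [qdriftLaw, integral_finsetSum_measure fun s _ =>
      (integrable_bornLaw _ _ _ F).smul_measure hw, mean, Finset.mul_sum]
    refine Finset.sum_congr rfl fun s _ => ?_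
    rw [integral_smul_measure, smul_eq_mul]
    congr 1
    rw [ENNReal.toReal_inv, ENNReal.toReal_pow, ENNReal.toReal_natCast]

theorem norm_ghz (K : ONB N) {x y : Fin N} (hxy : x ≠ y) (φ : ℝ) : ‖ghz K x y φ‖ = 1 := by
  have h1 : ‖K x + Complex.exp (Complex.I * φ) • K y‖ ^ 2 = 2 := by
    rw [norm_add_sq (𝕜 := ℂ), inner_smul_right, K.orthonormal.2 hxy, norm_smul, mul_comm Complex.I,
      Complex.norm_exp_ofReal_mul_I, K.orthonormal.1, K.orthonormal.1]
    norm_num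
  have h2 : ‖K x + Complex.exp (Complex.I * φ) • K y‖ = Real.sqrt 2 := by
    rw [← h1, Real.sqrt_sq (norm_nonneg _)]
  rw [ghz, norm_smul, h2, norm_div, Complex.norm_real, Real.norm_eq_abs, abs_of_nonneg
    (Real.sqrt_nonneg _), norm_one]
  field_simp

theorem act_readout (K : ONB N) (x y : Fin N) (ψ : Ket N) :
    act (readout K x y) ψ = (Complex.I * ⟪K y, ψ⟫_ℂ) • K x - (Complex.I * ⟪K x, ψ⟫_ℂ) • K y := by
  rw [readout, Matrix.conjTranspose_smul, conjTranspose_ketbra, act_add_left, act_smul_left,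
    act_smul_left, act_ketbra, act_ketbra, smul_smul, smul_smul, sub_eq_add_neg, ← neg_smul]
  simp

theorem inner_ghz_left (K : ONB N) {x y : Fin N} (hxy : x ≠ y) (φ : ℝ) :
    ⟪K x, ghz K x y φ⟫_ℂ = 1 / Real.sqrt 2 := by
  rw [ghz, inner_smul_right, inner_add_right, inner_smul_right, K.orthonormal.2 hxy,
    inner_self_eq_norm_sq_to_K, K.orthonormal.1]
  simp

theorem inner_ghz_right (K : ONB N) {x y : Fin N} (hxy : x ≠ y) (φ : ℝ) :
    ⟪K y, ghz K x y φ⟫_ℂ = 1 / Real.sqrt 2 * Complex.exp (Complex.I * φ) := by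
  rw [ghz, inner_smul_right, inner_add_right, inner_smul_right, K.orthonormal.2 hxy.symm,
    inner_self_eq_norm_sq_to_K, K.orthonormal.1]
  simp

theorem expectation_readout_ghz (K : ONB N) {x y : Fin N} (hxy : x ≠ y) (φ : ℝ) :
    expectation (readout K x y) (ghz K x y φ) = -Real.sin φ := by
  have h2 : (1 / Real.sqrt 2 : ℂ) * (1 / Real.sqrt 2) = 1 / 2 := by
    rw [div_mul_div_comm, one_mul, ← Complex.ofReal_mul, Real.mul_self_sqrt zero_le_two]
    norm_num
  have hconj : ∀ z, ⟪ghz K x y φ, K z⟫_ℂ = (starRingEnd ℂ) ⟪K z, ghz K x y φ⟫_ℂ :=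
    fun z => (inner_conj_symm _ _).symm
  have hc : (starRingEnd ℂ) (1 / Real.sqrt 2 : ℂ) = 1 / Real.sqrt 2 := by simp
  have he : (starRingEnd ℂ) (Complex.exp (Complex.I * φ)) = Complex.exp (-(Complex.I * φ)) := by
    rw [← Complex.exp_conj]
    simp
  rw [expectation, act_readout, inner_sub_right, inner_smul_right, inner_smul_right, hconj, hconj,
    inner_ghz_left K hxy, inner_ghz_right K hxy, map_mul, hc, he]
  have h3 : Complex.I * (1 / Real.sqrt 2 * Complex.exp (Complex.I * φ)) * (1 / Real.sqrt 2)
      - Complex.I * (1 / Real.sqrt 2) * (1 / Real.sqrt 2 * Complex.exp (-(Complex.I * φ)))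
      = ((-Real.sin φ : ℝ) : ℂ) := by
    have h4 : Complex.exp (Complex.I * φ) = Real.cos φ + Real.sin φ * Complex.I := by
      rw [mul_comm, Complex.exp_mul_I, Complex.ofReal_cos, Complex.ofReal_sin]
    have h5 : Complex.exp (-(Complex.I * φ)) = Real.cos φ - Real.sin φ * Complex.I := by
      rw [show -(Complex.I * (φ : ℂ)) = ((-φ : ℝ) : ℂ) * Complex.I by push_cast; ring,
        Complex.exp_mul_I, ← Complex.ofReal_cos, ← Complex.ofReal_sin, Real.cos_neg, Real.sin_neg]
      push_cast
      ring
    calc _ = Complex.I * ((1 / Real.sqrt 2) * (1 / Real.sqrt 2))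
          * (Complex.exp (Complex.I * φ) - Complex.exp (-(Complex.I * φ))) := by ring
      _ = Complex.I * Complex.I * Real.sin φ := by rw [h2, h4, h5]; ring
      _ = _ := by rw [Complex.I_mul_I]; push_cast; ring
  rw [h3, Complex.ofReal_re]

/-- The readout squares to the identity on the span of the two basis vectors. -/
theorem expectation_readout_sq_ghz (K : ONB N) {x y : Fin N} (hxy : x ≠ y) (φ : ℝ) :
    expectation (readout K x y * readout K x y) (ghz K x y φ) = 1 := by
  have h1 : act (readout K x y * readout K x y) (ghz K x y φ) = ghz K x y φ := by
    have hx : act (readout K x y) (K x) = -Complex.I • K y := by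
      rw [act_readout, K.orthonormal.2 hxy.symm, inner_self_eq_norm_sq_to_K, K.orthonormal.1]
      simp
    have hy : act (readout K x y) (K y) = Complex.I • K x := by
      rw [act_readout, K.orthonormal.2 hxy, inner_self_eq_norm_sq_to_K, K.orthonormal.1]
      simp
    rw [ghz, act_smul, act_add, act_smul, act_mul, act_mul, hx, hy, act_smul, act_smul, hx, hy,
      smul_smul Complex.I, smul_smul (-Complex.I)]
    simp
  rw [expectation, h1, inner_self_eq_norm_sq_to_K, norm_ghz K hxy]
  simp

/-- The variance of an affine function of the outcome, for a law with finite support. -/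
theorem variance_affine {μ : Measure ℝ} [IsProbabilityMeasure μ]
    (hμ : ∀ F : ℝ → ℝ, Integrable F μ) (c₀ c₁ : ℝ) :
    ProbabilityTheory.variance (fun o => c₀ + c₁ * o) μ
      = c₁ ^ 2 * (∫ o, o ^ 2 ∂μ - (∫ o, o ∂μ) ^ 2) := by
  have h : MemLp (fun o : ℝ => o) 2 μ :=
    (memLp_two_iff_integrable_sq (hμ _).aestronglyMeasurable).mpr (hμ _)
  rw [ProbabilityTheory.variance_const_add
    ((measurable_const_mul c₁).aestronglyMeasurable), ProbabilityTheory.variance_const_mul,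
    ProbabilityTheory.variance_eq_sub h]
  rfl

/-! ### Convergence of derivatives of uniformly bounded entire functions -/

/-- Cauchy's estimates bound the second derivative of a bounded holomorphic function, hence the
remainder of its first-order expansion. -/
theorem norm_taylor_remainder_le {F : ℂ → ℂ} (hF : Differentiable ℂ F) {C : ℝ}
    (hC : ∀ z, ‖z‖ ≤ 2 → ‖F z‖ ≤ C) {h : ℂ} (hh : ‖h‖ ≤ 1) :
    ‖F h - F 0 - h * deriv F 0‖ ≤ 4 * C * ‖h‖ ^ 2 := by
  have hC0 : 0 ≤ C := (norm_nonneg _).trans (hC 0 (by simp))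
  have hF' : Differentiable ℂ (deriv F) := hF.deriv
  have h1 : ∀ z, ‖z‖ ≤ 3 / 2 → ‖deriv F z‖ ≤ 2 * C := by
    intro z hz
    refine (Complex.norm_deriv_le_of_forall_mem_sphere_norm_le (R := 1 / 2) (C := C)
      (by norm_num) hF.diffContOnCl fun w hw => hC w ?_).trans (by linarith)
    have : ‖w‖ ≤ ‖w - z‖ + ‖z‖ := by simpa using norm_add_le (w - z) z
    rw [mem_sphere_iff_norm] at hw
    linarith
  have h2 : ∀ z, ‖z‖ ≤ 1 → ‖deriv (deriv F) z‖ ≤ 4 * C := by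
    intro z hz
    refine (Complex.norm_deriv_le_of_forall_mem_sphere_norm_le (R := 1 / 2) (C := 2 * C)
      (by norm_num) hF'.diffContOnCl fun w hw => h1 w ?_).trans (by linarith)
    have : ‖w‖ ≤ ‖w - z‖ + ‖z‖ := by simpa using norm_add_le (w - z) z
    rw [mem_sphere_iff_norm] at hw
    linarith
  have hconv : Convex ℝ (Metric.closedBall (0 : ℂ) ‖h‖) := convex_closedBall _ _
  have h0mem : (0 : ℂ) ∈ Metric.closedBall (0 : ℂ) ‖h‖ := by simp
  have hhmem : h ∈ Metric.closedBall (0 : ℂ) ‖h‖ := by simp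
  have h3 : ∀ z ∈ Metric.closedBall (0 : ℂ) ‖h‖, ‖deriv F z - deriv F 0‖ ≤ 4 * C * ‖h‖ := by
    intro z hz
    rw [mem_closedBall_zero_iff] at hz
    have := hconv.norm_image_sub_le_of_norm_deriv_le (f := deriv F) (C := 4 * C)
      (fun w _ => hF'.differentiableAt)
      (fun w hw => h2 w ((mem_closedBall_zero_iff.mp hw).trans hh)) h0mem
      (mem_closedBall_zero_iff.mpr hz)
    rw [sub_zero] at this
    exact this.trans (by gcongr)
  have hg : ∀ z, HasDerivAt (fun w => F w - w * deriv F 0) (deriv F z - deriv F 0) z := by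
    intro z
    have := (hF z).hasDerivAt.sub ((hasDerivAt_id z).mul_const (deriv F 0))
    rwa [one_mul] at this
  have h4 := hconv.norm_image_sub_le_of_norm_hasDerivWithin_le
    (fun z _ => (hg z).hasDerivWithinAt) h3 h0mem hhmem
  calc ‖F h - F 0 - h * deriv F 0‖ = ‖F h - h * deriv F 0 - (F 0 - 0 * deriv F 0)‖ := by
        congr 1
        ring
    _ ≤ 4 * C * ‖h‖ * ‖h - 0‖ := h4
    _ = _ := by rw [sub_zero]; ring

/-- Pointwise convergence of functions whose first-order expansions hold with a common quadratic
error implies convergence of the derivatives. -/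
theorem tendsto_deriv_of_uniform_remainder {f : ℕ → ℝ → ℝ} {f' : ℕ → ℝ} {F : ℝ → ℝ} {F' C : ℝ}
    (hlim : ∀ h, Tendsto (fun L => f L h) atTop (𝓝 (F h))) (hF : HasDerivAt F F' 0)
    (hrem : ∀ L h, |h| ≤ 1 → |f L h - f L 0 - h * f' L| ≤ C * h ^ 2) :
    Tendsto f' atTop (𝓝 F') := by
  rw [Metric.tendsto_atTop]
  intro ε hε
  have hslope := hasDerivAt_iff_tendsto_slope_zero.mp hF
  have h1 : ∀ᶠ h in 𝓝[≠] (0 : ℝ), |h⁻¹ • (F (0 + h) - F 0) - F'| < ε / 3 :=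
    (Metric.tendsto_nhds.mp hslope) (ε / 3) (by positivity)
  have h2 : ∀ᶠ h in 𝓝[≠] (0 : ℝ), |h| < 1 ∧ C * |h| < ε / 3 := by
    refine nhdsWithin_le_nhds (Filter.Eventually.and ?_ ?_)
    · exact (continuous_abs.tendsto' (0 : ℝ) 0 (by simp)).eventually_lt_const one_pos
    · have : Tendsto (fun h : ℝ => C * |h|) (𝓝 0) (𝓝 0) :=
        (continuous_const.mul continuous_abs).tendsto' _ _ (by simp)
      exact this.eventually_lt_const (by positivity)
  -- fix an increment `h` for which both the slope of `F` and the common error are `ε / 3`-close;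
  -- then compare the slopes at this fixed `h` for large `L`
  obtain ⟨h, ⟨hs, hh1, hhC⟩, hne⟩ :=
    ((h1.and h2).and (self_mem_nhdsWithin : ∀ᶠ h in 𝓝[≠] (0 : ℝ), h ≠ 0)).exists
  have hpos : 0 < |h| := abs_pos.mpr hne
  have h3 : Tendsto (fun L => h⁻¹ * (f L h - f L 0)) atTop (𝓝 (h⁻¹ * (F h - F 0))) :=
    ((hlim h).sub (hlim 0)).const_mul _
  obtain ⟨L₀, hL₀⟩ := (Metric.tendsto_atTop.mp h3) (ε / 3) (by positivity)
  refine ⟨L₀, fun L hL => ?_⟩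
  have h4 := hL₀ L hL
  rw [Real.dist_eq] at h4 ⊢
  have h5 : |h⁻¹ * (f L h - f L 0) - f' L| ≤ C * |h| := by
    have : h⁻¹ * (f L h - f L 0) - f' L = h⁻¹ * (f L h - f L 0 - h * f' L) := by
      rw [mul_sub h⁻¹ (f L h - f L 0), inv_mul_cancel_left₀ hne]
    rw [this, abs_mul, abs_inv]
    calc |h|⁻¹ * |f L h - f L 0 - h * f' L| ≤ |h|⁻¹ * (C * h ^ 2) := by
          gcongr
          exact hrem L h hh1.le
      _ = C * |h| := by
          rw [← sq_abs]
          field_simp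
  rw [zero_add, smul_eq_mul] at hs
  rw [abs_lt] at hs h4 ⊢
  rw [abs_le] at h5
  constructor <;> linarith [hs.1, hs.2, h4.1, h4.2, h5.1, h5.2]

/-! ### The randomized evolution as a function of the Hamiltonian -/

theorem differentiable_prod_ofFn {E : Type*} [NormedAddCommGroup E] [NormedSpace ℂ E] {L : ℕ}
    (X : Fin L → E → Op N) (hX : ∀ l, Differentiable ℂ (X l)) :
    Differentiable ℂ fun e => (List.ofFn fun l => X l e).reverse.prod := by
  induction L with
  | zero => simp
  | succ L ih =>
    simp only [reverse_prod_ofFn_succ]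
    exact (ih (fun l => X l.succ) fun l => hX _).mul (hX 0)

theorem differentiable_exp_smul (c : ℂ) :
    Differentiable ℂ fun H : Op N => NormedSpace.exp (c • H) := fun H =>
  (NormedSpace.exp_analytic (𝕂 := ℂ) (c • H)).differentiableAt.comp H
    (differentiableAt_id.const_smul c)

theorem differentiable_qdriftDrift (K : ONB N) (t : ℝ) (L : ℕ) (s : Fin L → Fin N) (u v : ℝ) :
    Differentiable ℂ fun H : Op N => qdriftDrift K H t L s u v :=
  differentiable_prod_ofFn (fun l H => (clock K (s l))ᴴ
      * NormedSpace.exp ((-(Complex.I * (overlap t L (l : ℕ) u v : ℂ))) • H) * clock K (s l))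
    fun _ => ((differentiable_exp_smul _).const_mul _).mul_const _

theorem differentiable_propagate {E : Type*} [NormedAddCommGroup E] [NormedSpace ℂ E]
    {W : E → ℝ → ℝ → Op N} (hW : ∀ u v, Differentiable ℂ fun e => W e u v) (T s : ℝ)
    (G : List (ℝ × Op N)) : Differentiable ℂ fun e => propagate (W e) T s G := by
  induction G generalizing s with
  | nil => exact hW s T
  | cons p G ih => exact ((ih p.1).mul_const p.2).mul (hW s p.1)

theorem norm_qdriftDrift_le (K : ONB N) (H : Op N) {t : ℝ} (ht : 0 ≤ t) (L : ℕ)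
    (s : Fin L → Fin N) (u v : ℝ) : ‖qdriftDrift K H t L s u v‖ ≤ Real.exp (t * ‖H‖) := by
  refine (norm_prod_ofFn_le _ (fun l => Real.exp (overlap t L l u v * ‖H‖)) fun l => ?_).trans ?_
  · refine (norm_conj_clock_le K (s l) _).trans ((norm_exp_le _).trans (le_of_eq ?_))
    rw [norm_smul, norm_neg, norm_mul, Complex.norm_I, one_mul, Complex.norm_real,
      Real.norm_eq_abs, abs_of_nonneg (overlap_nonneg _ _ _ _ _)]
  · rw [← Real.exp_sum, ← Finset.sum_mul]
    gcongr
    exact sum_overlap_le ht L u v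

theorem norm_propagate_le {W : ℝ → ℝ → Op N} {b : ℝ} (hW : ∀ u v, ‖W u v‖ ≤ b) (T s : ℝ)
    {G : List (ℝ × Op N)} (hG : ∀ p ∈ G, p.2ᴴ * p.2 = 1) :
    ‖propagate W T s G‖ ≤ b ^ (G.length + 1) := by
  have hb : 0 ≤ b := (norm_nonneg _).trans (hW 0 0)
  induction G generalizing s with
  | nil => simpa [propagate] using hW s T
  | cons p G ih =>
    have h1 := ih p.1 fun q hq => hG q (List.mem_cons_of_mem _ hq)
    have h2 := norm_le_one_of_unitary (hG p (by simp))
    calc ‖propagate W T p.1 G * p.2 * W s p.1‖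
        ≤ ‖propagate W T p.1 G‖ * ‖p.2‖ * ‖W s p.1‖ :=
          (norm_mul_le _ _).trans (by gcongr; exact norm_mul_le _ _)
      _ ≤ b ^ (G.length + 1) * 1 * b := by
          gcongr
          exact hW _ _
      _ = _ := by rw [List.length_cons, pow_succ b (G.length + 1), mul_one]

/-- The sesquilinear matrix element `⟨V(z̄) ψ, O V(z) ψ⟩` is holomorphic in `z`. -/
theorem differentiable_inner_conj {V : ℂ → Op N} (hV : Differentiable ℂ V) (O : Op N)
    (ψ : Ket N) :
    Differentiable ℂ fun z => ⟪act (V ((starRingEnd ℂ) z)) ψ, act O (act (V z) ψ)⟫_ℂ := by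
  have hact : ∀ χ : Ket N, Differentiable ℂ fun z => ⟪χ, act (V z) ψ⟫_ℂ := by
    intro χ
    let T : Op N →ₗ[ℂ] ℂ :=
      { toFun := fun V => ⟪χ, act V ψ⟫_ℂ
        map_add' := fun V W => by rw [act_add_left, inner_add_right]
        map_smul' := fun c V => by rw [act_smul_left, inner_smul_right]; rfl }
    exact (LinearMap.toContinuousLinearMap T).differentiable.comp hV
  let K : ONB N := EuclideanSpace.basisFun (Fin N) ℂ
  have h : ∀ z, ⟪act (V ((starRingEnd ℂ) z)) ψ, act O (act (V z) ψ)⟫_ℂ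
      = ∑ k, (starRingEnd ℂ) ⟪K k, act (V ((starRingEnd ℂ) z)) ψ⟫_ℂ
        * ⟪act Oᴴ (K k), act (V z) ψ⟫_ℂ := by
    intro z
    rw [← K.sum_inner_mul_inner]
    simp only [inner_conj_symm, inner_act_conjTranspose]
  simp only [h]
  -- conjugating both the argument and the value preserves holomorphy
  refine Differentiable.fun_sum fun k _ => Differentiable.mul (fun z => ?_) (hact _)
  have := (hact (K k) ((starRingEnd ℂ) z)).conj_conj
  simpa [Function.comp_def] using this

/-! ### Expectation values in the randomized protocol -/

/-- The expectation of `O` after the randomized evolution with `L` steps, under the Hamiltonian `H`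
and interrupted by the gates `G`, averaged over the random choices. -/
def randomizedExpectation (K : ONB N) (t : ℝ) (G : List (ℝ × Op N)) (O : Op N) (ψ : Ket N) (L : ℕ)
    (H : Op N) : ℝ :=
  mean fun s : Fin L → Fin N => expectation O (act (propagate (qdriftDrift K H t L s) t 0 G) ψ)

/-- The expectation of `O` after the dephased evolution interrupted by the gates `G`. -/
def dephasedExpectation (K : ONB N) (t : ℝ) (G : List (ℝ × Op N)) (O : Op N) (ψ : Ket N)
    (H : Op N) : ℝ :=
  expectation O (act (propagate (idealDrift K H) t 0 G) ψ)

theorem abs_randomizedExpectation_sub_le (hN : N ≠ 0) (K : ONB N) {t : ℝ} (ht : 0 ≤ t)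
    {G : List (ℝ × Op N)} (hG : IsSchedule 0 t G) (O : Op N) {ψ : Ket N} (hψ : ‖ψ‖ = 1)
    {H : Op N} (hH : H.IsHermitian) {B : ℝ} (hB : ‖H‖ ≤ B) {L : ℕ} (hL : L ≠ 0) :
    |randomizedExpectation K t G O ψ L H - dephasedExpectation K t G O ψ H|
      ≤ 2 * ‖O‖ * ((G.length + 1) * segmentError N t B L) := by
  have h1 := mean_norm_propagate_sub_le hN K hH hB ht hL le_rfl ht hG
  rw [randomizedExpectation, ← mean_const hN (L := L) (dephasedExpectation K t G O ψ H),
    ← mean_sub]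
  refine (abs_mean_le _).trans ((mean_mono fun s => ?_).trans
    ((mean_const_mul (2 * ‖O‖) _).trans_le (mul_le_mul_of_nonneg_left h1 (by positivity))))
  have hV := propagate_unitary (qdriftDrift_unitary K hH t L s) t 0 hG.unitary
  have hD := propagate_unitary (idealDrift_unitary K hH) t 0 hG.unitary
  refine (abs_expectation_sub_le O (by rw [norm_act_of_unitary hV, hψ])
    (by rw [norm_act_of_unitary hD, hψ])).trans ?_
  rw [← act_sub_left]
  gcongr
  exact (norm_act_le _ _).trans (by rw [hψ, mul_one])

theorem tendsto_randomizedExpectation (hN : N ≠ 0) (K : ONB N) {t : ℝ} (ht : 0 ≤ t)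
    {G : List (ℝ × Op N)} (hG : IsSchedule 0 t G) (O : Op N) {ψ : Ket N} (hψ : ‖ψ‖ = 1)
    {H : Op N} (hH : H.IsHermitian) :
    Tendsto (fun L => randomizedExpectation K t G O ψ L H) atTop
      (𝓝 (dephasedExpectation K t G O ψ H)) := by
  rw [tendsto_iff_dist_tendsto_zero]
  have h := ((tendsto_segmentError N t ‖H‖).const_mul ((G.length : ℝ) + 1)).const_mul (2 * ‖O‖)
  rw [mul_zero, mul_zero] at h
  refine squeeze_zero' (Eventually.of_forall fun L => dist_nonneg) ?_ h
  filter_upwards [eventually_ne_atTop 0] with L hL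
  exact abs_randomizedExpectation_sub_le hN K ht hG O hψ hH le_rfl hL

theorem hamiltonian_add_smul (g : Fin m → Op N) (θ v : Fin m → ℝ) (h : ℝ) :
    hamiltonian g (θ + h • v) = hamiltonian g θ + (h : ℂ) • hamiltonian g v := by
  simp only [hamiltonian, Pi.add_apply, Pi.smul_apply, smul_eq_mul, Complex.ofReal_add,
    Complex.ofReal_mul, add_smul, Finset.sum_add_distrib, Finset.smul_sum, smul_smul]

theorem norm_hamiltonian_le (g : Fin m → Op N) {R : ℝ} {θ : Fin m → ℝ}
    (hθ : θ ∈ Metric.closedBall 0 R) : ‖hamiltonian g θ‖ ≤ ∑ j, R * ‖g j‖ := by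
  refine norm_sum_le_of_le _ fun j _ => ?_
  rw [norm_smul, Complex.norm_real]
  gcongr
  exact (norm_le_pi_norm θ j).trans (mem_closedBall_zero_iff.mp hθ)

theorem differentiable_hamiltonian (g : Fin m → Op N) : Differentiable ℝ (hamiltonian g) := by
  let T : (Fin m → ℝ) →ₗ[ℝ] Op N :=
    { toFun := hamiltonian g
      map_add' := fun θ v => by simpa using hamiltonian_add_smul g θ v 1
      map_smul' := fun h v => by
        have h0 : hamiltonian g 0 = 0 := by simp [hamiltonian]
        have := hamiltonian_add_smul g 0 v h
        rw [zero_add, h0, zero_add] at this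
        rw [this, RingHom.id_apply, Complex.coe_smul] }
  exact (LinearMap.toContinuousLinearMap T).differentiable

theorem tendstoUniformlyOn_randomizedExpectation (hN : N ≠ 0) (K : ONB N) {t : ℝ} (ht : 0 ≤ t)
    {G : List (ℝ × Op N)} (hG : IsSchedule 0 t G) (O : Op N) {ψ : Ket N} (hψ : ‖ψ‖ = 1)
    {g : Fin m → Op N} (hherm : ∀ j, (g j).IsHermitian) (R : ℝ) :
    TendstoUniformlyOn (fun L θ => randomizedExpectation K t G O ψ L (hamiltonian g θ))
      (fun θ => dephasedExpectation K t G O ψ (hamiltonian g θ)) atTop (Metric.closedBall 0 R) := by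
  rw [Metric.tendstoUniformlyOn_iff]
  intro ε hε
  have h := ((tendsto_segmentError N t (∑ j, R * ‖g j‖)).const_mul
    ((G.length : ℝ) + 1)).const_mul (2 * ‖O‖)
  rw [mul_zero, mul_zero] at h
  filter_upwards [eventually_ne_atTop 0, h.eventually_lt_const hε] with L hL hlt θ hθ
  rw [dist_comm]
  exact (abs_randomizedExpectation_sub_le hN K ht hG O hψ (isHermitian_hamiltonian hherm θ)
    (norm_hamiltonian_le g hθ) hL).trans_lt hlt

theorem differentiable_randomizedExpectation (K : ONB N) (t : ℝ) (G : List (ℝ × Op N)) (O : Op N)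
    (ψ : Ket N) (g : Fin m → Op N) (L : ℕ) :
    Differentiable ℝ fun θ => randomizedExpectation K t G O ψ L (hamiltonian g θ) := by
  unfold randomizedExpectation mean
  refine Differentiable.const_mul (Differentiable.fun_sum fun s _ => ?_) _
  have hV : Differentiable ℝ fun θ => propagate (qdriftDrift K (hamiltonian g θ) t L s) t 0 G :=
    ((differentiable_propagate (fun u v => differentiable_qdriftDrift K t L s u v) t 0
      G).restrictScalars ℝ).comp (differentiable_hamiltonian g)
  have hact : ∀ χ : Ket N, Differentiable ℝ fun V : Op N => act V χ := by
    intro χ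
    let T : Op N →ₗ[ℂ] Ket N :=
      { toFun := fun V => act V χ
        map_add' := fun V W => act_add_left V W χ
        map_smul' := fun c V => act_smul_left c V χ }
    exact (LinearMap.toContinuousLinearMap T).differentiable.restrictScalars ℝ
  have hO : Differentiable ℝ fun χ : Ket N => act O χ :=
    (LinearMap.toContinuousLinearMap (Matrix.toEuclideanLin O)).differentiable.restrictScalars ℝ
  have h1 : Differentiable ℝ fun θ =>
      act (propagate (qdriftDrift K (hamiltonian g θ) t L s) t 0 G) ψ := (hact ψ).comp hV
  have h2 : Differentiable ℝ fun θ =>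
      act O (act (propagate (qdriftDrift K (hamiltonian g θ) t L s) t 0 G) ψ) := hO.comp h1
  exact Complex.reCLM.differentiable.comp (h1.inner ℂ h2)

/-- Along a line, the averaged expectation extends to an entire function that is bounded on the disk
of radius `2` uniformly in the number of steps; hence its first-order expansion has a remainder
that is quadratic uniformly in the number of steps. -/
theorem exists_taylor_bound_randomizedExpectation (hN : N ≠ 0) (K : ONB N) {t : ℝ} (ht : 0 ≤ t)
    {G : List (ℝ × Op N)} (hG : IsSchedule 0 t G) (O : Op N) {ψ : Ket N} (hψ : ‖ψ‖ = 1)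
    (g : Fin m → Op N) (θ v : Fin m → ℝ) :
    ∃ C : ℝ, ∀ (L : ℕ) (h : ℝ), |h| ≤ 1 →
      |randomizedExpectation K t G O ψ L (hamiltonian g (θ + h • v))
        - randomizedExpectation K t G O ψ L (hamiltonian g (θ + (0 : ℝ) • v))
        - h * fderiv ℝ (fun θ => randomizedExpectation K t G O ψ L (hamiltonian g θ)) θ v|
      ≤ C * h ^ 2 := by
  set A : Op N := hamiltonian g θ with hA
  set D : Op N := hamiltonian g v with hD
  set M : ℝ := Real.exp (t * (‖A‖ + 2 * ‖D‖)) ^ (G.length + 1) with hM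
  refine ⟨4 * (M * (‖O‖ * M)), fun L h hh => ?_⟩
  let V : (Fin L → Fin N) → ℂ → Op N :=
    fun s z => propagate (qdriftDrift K (A + z • D) t L s) t 0 G
  have hV : ∀ s, Differentiable ℂ (V s) := fun s =>
    (differentiable_propagate (fun u v => differentiable_qdriftDrift K t L s u v) t 0 G).comp
      ((differentiable_const A).add (differentiable_id.smul_const D))
  have hVn : ∀ s z, ‖z‖ ≤ 2 → ‖act (V s z) ψ‖ ≤ M := by
    intro s z hz
    refine (norm_act_le _ _).trans ?_
    rw [hψ, mul_one]
    refine norm_propagate_le (fun u v => (norm_qdriftDrift_le K _ ht L s u v).trans ?_) t 0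
      hG.unitary
    gcongr
    refine (norm_add_le _ _).trans ?_
    rw [norm_smul]
    gcongr
  let Φ : ℂ → ℂ := fun z => ((N : ℂ) ^ L)⁻¹ *
    ∑ s, ⟪act (V s ((starRingEnd ℂ) z)) ψ, act O (act (V s z) ψ)⟫_ℂ
  have hΦ : Differentiable ℂ Φ :=
    (Differentiable.fun_sum fun s _ => differentiable_inner_conj (hV s) O ψ).const_mul _
  have hΦn : ∀ z, ‖z‖ ≤ 2 → ‖Φ z‖ ≤ M * (‖O‖ * M) := by
    intro z hz
    have h1 : ‖Φ z‖ ≤ mean fun _ : Fin L → Fin N => M * (‖O‖ * M) := by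
      rw [norm_mul, norm_inv, norm_pow, Complex.norm_natCast, mean]
      gcongr
      refine norm_sum_le_of_le _ fun s _ => (norm_inner_le_norm _ _).trans ?_
      have h2 := hVn s z hz
      have h3 := hVn s ((starRingEnd ℂ) z) (by rwa [RCLike.norm_conj])
      have h4 : ‖act O (act (V s z) ψ)‖ ≤ ‖O‖ * M := (norm_act_le _ _).trans (by gcongr)
      exact mul_le_mul h3 h4 (norm_nonneg _) ((norm_nonneg _).trans h3)
    rwa [mean_const hN] at h1
  have hre : ∀ r : ℝ, (Φ r).re = randomizedExpectation K t G O ψ L (hamiltonian g (θ + r • v)) := by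
    -- at real arguments the conjugation is invisible
    intro r
    have h3 : ((N : ℂ) ^ L)⁻¹ = ((((N : ℝ) ^ L)⁻¹ : ℝ) : ℂ) := by push_cast; rfl
    simp only [Φ]
    rw [h3, Complex.re_ofReal_mul, Complex.re_sum, randomizedExpectation, mean,
      hamiltonian_add_smul, Complex.conj_ofReal]
    rfl
  have hderiv : (deriv Φ 0).re
      = fderiv ℝ (fun θ => randomizedExpectation K t G O ψ L (hamiltonian g θ)) θ v := by
    have h1 : HasDerivAt (fun r : ℝ => (Φ r).re) (deriv Φ 0).re 0 := by
      have : HasDerivAt Φ (deriv Φ 0) ((0 : ℝ) : ℂ) := by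
        rw [Complex.ofReal_zero]
        exact (hΦ 0).hasDerivAt
      exact this.real_of_complex
    have h2 : HasDerivAt (fun r : ℝ => θ + r • v) v 0 := by
      simpa using ((hasDerivAt_id (0 : ℝ)).smul_const v).const_add θ
    have h3 : HasFDerivAt (fun θ => randomizedExpectation K t G O ψ L (hamiltonian g θ))
        (fderiv ℝ (fun θ => randomizedExpectation K t G O ψ L (hamiltonian g θ)) θ)
        (θ + (0 : ℝ) • v) := by
      rw [zero_smul, add_zero]
      exact (differentiable_randomizedExpectation K t G O ψ g L θ).hasFDerivAt
    have h4 := h3.comp_hasDerivAt (0 : ℝ) h2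
    refine h1.unique (h4.congr_of_eventuallyEq (Eventually.of_forall fun r => ?_))
    exact hre r
  rw [← hderiv, ← hre, ← hre]
  have hfinal := norm_taylor_remainder_le hΦ hΦn (h := (h : ℂ)) (by rwa [Complex.norm_real])
  rw [Complex.norm_real, Real.norm_eq_abs, sq_abs] at hfinal
  have h5 : (Φ h).re - (Φ ((0 : ℝ) : ℂ)).re - h * (deriv Φ 0).re
      = (Φ h - Φ 0 - h * deriv Φ 0).re := by
    rw [Complex.sub_re, Complex.sub_re, Complex.re_ofReal_mul, Complex.ofReal_zero]
  rw [h5]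
  exact (Complex.abs_re_le_norm _).trans hfinal

theorem tendsto_of_tendsto_single {f : ℕ → (Fin m → ℝ) →L[ℝ] ℝ} {F : (Fin m → ℝ) →L[ℝ] ℝ}
    (h : ∀ j, Tendsto (fun L => f L (Pi.single j 1)) atTop (𝓝 (F (Pi.single j 1)))) :
    Tendsto f atTop (𝓝 F) := by
  have hsum : ∀ T : (Fin m → ℝ) →L[ℝ] ℝ,
      T = ∑ j, T (Pi.single j 1) • (ContinuousLinearMap.proj j : (Fin m → ℝ) →L[ℝ] ℝ) := by
    intro T
    ext w
    conv_lhs => rw [pi_eq_sum_univ' w]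
    simp [mul_comm]
  rw [hsum F, funext fun L => hsum (f L)]
  exact tendsto_finsetSum _ fun j _ => (h j).smul_const _

theorem tendsto_fderiv_randomizedExpectation (hN : N ≠ 0) (K : ONB N) {t : ℝ} (ht : 0 ≤ t)
    {G : List (ℝ × Op N)} (hG : IsSchedule 0 t G) (O : Op N) {ψ : Ket N} (hψ : ‖ψ‖ = 1)
    {g : Fin m → Op N} (hherm : ∀ j, (g j).IsHermitian) (θ : Fin m → ℝ)
    {F' : (Fin m → ℝ) →L[ℝ] ℝ}
    (hF : HasFDerivAt (fun θ => dephasedExpectation K t G O ψ (hamiltonian g θ)) F' θ) :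
    Tendsto (fun L =>
      fderiv ℝ (fun θ => randomizedExpectation K t G O ψ L (hamiltonian g θ)) θ) atTop (𝓝 F') := by
  refine tendsto_of_tendsto_single fun j => ?_
  set v : Fin m → ℝ := Pi.single j 1 with hv
  obtain ⟨C, hC⟩ := exists_taylor_bound_randomizedExpectation hN K ht hG O hψ g θ v
  have h2 : HasDerivAt (fun r : ℝ => θ + r • v) v 0 := by
    simpa using ((hasDerivAt_id (0 : ℝ)).smul_const v).const_add θ
  have h3 : HasFDerivAt (fun θ => dephasedExpectation K t G O ψ (hamiltonian g θ)) F'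
      (θ + (0 : ℝ) • v) := by
    rwa [zero_smul, add_zero]
  have h4 := h3.comp_hasDerivAt (0 : ℝ) h2
  exact tendsto_deriv_of_uniform_remainder
    (F := fun r : ℝ => dephasedExpectation K t G O ψ (hamiltonian g (θ + r • v)))
    (fun h => tendsto_randomizedExpectation hN K ht hG O hψ (isHermitian_hamiltonian hherm _))
    h4 hC

/-! ### The outcome laws of the two protocols -/

theorem integral_affine {μ : Measure ℝ} [IsProbabilityMeasure μ]
    (hμ : ∀ F : ℝ → ℝ, Integrable F μ) (c₀ c₁ : ℝ) :
    ∫ o, (c₀ + c₁ * o) ∂μ = c₀ + c₁ * ∫ o, o ∂μ := by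
  rw [integral_add (hμ _) (hμ _), integral_const, integral_const_mul]
  simp

theorem isProbabilityMeasure_idealLaw (K : ONB N) (a : Fin N → ℝ) (t : ℝ) {x₀ : Fin N}
    {xs : List (Fin N)} {y₀ : Fin N} {ys : List (Fin N)}
    (hG : IsSchedule 0 t (gates K a t (x₀ :: xs) (y₀ :: ys))) (hxy : x₀ ≠ y₀) (φ : ℝ) {H : Op N}
    (hH : H.IsHermitian) : IsProbabilityMeasure (idealLaw K a t x₀ xs y₀ ys φ H) := by
  refine ⟨bornLaw_univ _ _ ?_⟩
  rw [idealProtocol,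
    norm_act_of_unitary (propagate_unitary (idealDrift_unitary K hH) t 0 hG.unitary),
    norm_ghz K hxy]

theorem isProbabilityMeasure_qdriftLaw (hN : N ≠ 0) (K : ONB N) (a : Fin N → ℝ) (t : ℝ)
    {x₀ : Fin N} {xs : List (Fin N)} {y₀ : Fin N} {ys : List (Fin N)}
    (hG : IsSchedule 0 t (gates K a t (x₀ :: xs) (y₀ :: ys))) (hxy : x₀ ≠ y₀) (φ : ℝ) {H : Op N}
    (hH : H.IsHermitian) (L : ℕ) :
    IsProbabilityMeasure (qdriftLaw K a t x₀ xs y₀ ys φ H L) := by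
  have hN' : (N : ENNReal) ^ L ≠ 0 := pow_ne_zero _ (by exact_mod_cast hN)
  have hone : ∀ s : Fin L → Fin N,
      bornLaw _ (readout_isHermitian K ((x₀ :: xs).getLast (by simp))
          ((y₀ :: ys).getLast (by simp)))
        (act (qdriftProtocol K a t (x₀ :: xs) (y₀ :: ys) H L s) (ghz K x₀ y₀ φ)) Set.univ = 1 := by
    intro s
    refine bornLaw_univ _ _ ?_
    rw [qdriftProtocol,
      norm_act_of_unitary (propagate_unitary (qdriftDrift_unitary K hH t L s) t 0 hG.unitary),
      norm_ghz K hxy]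
  constructor
  rw [qdriftLaw, Measure.finsetSum_apply]
  simp only [Measure.smul_apply, hone, smul_eq_mul, mul_one, Finset.sum_const, Finset.card_univ,
    Fintype.card_fun, Fintype.card_fin, nsmul_eq_mul, Nat.cast_pow]
  exact ENNReal.mul_inv_cancel hN' (ENNReal.pow_ne_top (ENNReal.natCast_ne_top N))

theorem idealLaw_moments (K : ONB N) (a : Fin N → ℝ) (t : ℝ) (x₀ : Fin N) (xs : List (Fin N))
    (y₀ : Fin N) (ys : List (Fin N)) (φ : ℝ) (H : Op N) :
    (∀ F : ℝ → ℝ, Integrable F (idealLaw K a t x₀ xs y₀ ys φ H)) ∧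
    ∫ o, o ∂(idealLaw K a t x₀ xs y₀ ys φ H)
      = dephasedExpectation K t (gates K a t (x₀ :: xs) (y₀ :: ys))
        (readout K ((x₀ :: xs).getLast (by simp)) ((y₀ :: ys).getLast (by simp)))
        (ghz K x₀ y₀ φ) H ∧
    ∫ o, o ^ 2 ∂(idealLaw K a t x₀ xs y₀ ys φ H)
      = dephasedExpectation K t (gates K a t (x₀ :: xs) (y₀ :: ys))
        (readout K ((x₀ :: xs).getLast (by simp)) ((y₀ :: ys).getLast (by simp))
          * readout K ((x₀ :: xs).getLast (by simp)) ((y₀ :: ys).getLast (by simp)))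
        (ghz K x₀ y₀ φ) H :=
  ⟨fun F => integrable_bornLaw _ _ _ F, integral_id_bornLaw _ _ _, integral_sq_bornLaw _ _ _⟩

theorem qdriftLaw_moments (hN : N ≠ 0) (K : ONB N) (a : Fin N → ℝ) (t : ℝ) (x₀ : Fin N)
    (xs : List (Fin N)) (y₀ : Fin N) (ys : List (Fin N)) (φ : ℝ) (H : Op N) (L : ℕ) :
    (∀ F : ℝ → ℝ, Integrable F (qdriftLaw K a t x₀ xs y₀ ys φ H L)) ∧
    ∫ o, o ∂(qdriftLaw K a t x₀ xs y₀ ys φ H L)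
      = randomizedExpectation K t (gates K a t (x₀ :: xs) (y₀ :: ys))
        (readout K ((x₀ :: xs).getLast (by simp)) ((y₀ :: ys).getLast (by simp)))
        (ghz K x₀ y₀ φ) L H ∧
    ∫ o, o ^ 2 ∂(qdriftLaw K a t x₀ xs y₀ ys φ H L)
      = randomizedExpectation K t (gates K a t (x₀ :: xs) (y₀ :: ys))
        (readout K ((x₀ :: xs).getLast (by simp)) ((y₀ :: ys).getLast (by simp))
          * readout K ((x₀ :: xs).getLast (by simp)) ((y₀ :: ys).getLast (by simp)))
        (ghz K x₀ y₀ φ) L H := by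
  refine ⟨fun F => (integral_qdriftLaw K a t x₀ xs y₀ ys φ H L hN F).1, ?_, ?_⟩
  · rw [(integral_qdriftLaw K a t x₀ xs y₀ ys φ H L hN fun o => o).2]
    simp only [integral_id_bornLaw]
    rfl
  · rw [(integral_qdriftLaw K a t x₀ xs y₀ ys φ H L hN fun o => o ^ 2).2]
    simp only [integral_sq_bornLaw]
    rfl

theorem estimator_eq (γ t φ q₀ : ℝ) : estimator γ t φ q₀ = fun o =>
    (q₀ + Real.sin (φ + q₀ * t / γ) * (-(t / γ) * Real.cos (φ + q₀ * t / γ))⁻¹)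
      + (-(t / γ) * Real.cos (φ + q₀ * t / γ))⁻¹ * o := by
  funext o
  rw [estimator, div_eq_mul_inv]
  ring

theorem tendsto_uniformOn_protocol_sub (hN : N ≠ 0) (K : ONB N) (a : Fin N → ℝ) {t : ℝ}
    (ht : 0 ≤ t) {xs ys : List (Fin N)} (hG : IsSchedule 0 t (gates K a t xs ys)) {H : Op N}
    (hH : H.IsHermitian) {ε : ℝ} (hε : 0 < ε) :
    Tendsto (fun L : ℕ => ProbabilityTheory.uniformOn (Set.univ : Set (Fin L → Fin N))
      {s | ε ≤ spectralNorm (qdriftProtocol K a t xs ys H L s - idealProtocol K a t xs ys H)})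
      atTop (𝓝 0) := by
  have hlim := (((tendsto_segmentError N t (spectralNorm H)).const_mul
    (((gates K a t xs ys).length : ℝ) + 1)).div_const ε)
  rw [mul_zero, zero_div] at hlim
  have hlim' := ENNReal.tendsto_ofReal hlim
  rw [ENNReal.ofReal_zero] at hlim'
  refine tendsto_of_tendsto_of_tendsto_of_le_of_le' tendsto_const_nhds hlim'
    (Eventually.of_forall fun L => zero_le) ?_
  filter_upwards [eventually_ne_atTop 0] with L hL
  refine (uniformOn_le_mean hN (fun s => norm_nonneg _) hε).trans (ENNReal.ofReal_le_ofReal ?_)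
  gcongr
  exact mean_norm_propagate_sub_le hN K hH le_rfl ht hL le_rfl ht hG

end FunctionEstimation

end

theorem mainTheorem2 {N m : ℕ} (g : Fin m → FunctionEstimation.Op N)
    (hherm : ∀ j, (g j).IsHermitian) (htrace : ∀ j, (g j).trace = 0)
    (hindep : LinearIndependent ℝ g)
    (α : Fin m → ℝ) (hα : α ≠ 0) (t : ℝ) (ht : 0 < t) :
    0 < FunctionEstimation.gammaOpt g α ∧
    (∃ A, FunctionEstimation.IsOptimal g α A) ∧
    ∀ A, FunctionEstimation.IsOptimal g α A →
    ∀ (K : FunctionEstimation.ONB N) (a : Fin N → ℝ),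
      A = ∑ k, (a k : ℂ) • FunctionEstimation.ketbra K k k →
    -- both signs occur among the eigenvalues
    (∃ k, 0 < a k) ∧ (∃ k, a k < 0) ∧
    -- averaging over the character unitaries dephases the Hamiltonian
    (∀ θ : Fin m → ℝ,
      (N : ℂ)⁻¹ • ∑ s, (FunctionEstimation.clock K s)ᴴ * FunctionEstimation.hamiltonian g θ
          * FunctionEstimation.clock K s
        = FunctionEstimation.diagPart K (FunctionEstimation.hamiltonian g θ)) ∧
    -- for every enumeration of the positive and of the negative eigenvectors
    ∀ (x₀ : Fin N) (xs : List (Fin N)) (y₀ : Fin N) (ys : List (Fin N)),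
      (x₀ :: xs).Nodup → (∀ k, k ∈ x₀ :: xs ↔ 0 < a k) →
      (y₀ :: ys).Nodup → (∀ k, k ∈ y₀ :: ys ↔ a k < 0) →
    -- the relative phase accumulated under the dephased Hamiltonian is `q t / γ`
    (∀ (θ : Fin m → ℝ) (φ : ℝ), ∃ c : ℂ, ‖c‖ = 1 ∧
      FunctionEstimation.act
          (FunctionEstimation.idealProtocol K a t (x₀ :: xs) (y₀ :: ys)
            (FunctionEstimation.hamiltonian g θ))
          (FunctionEstimation.ghz K x₀ y₀ φ)
        = c • FunctionEstimation.ghz K ((x₀ :: xs).getLast (by simp))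
            ((y₀ :: ys).getLast (by simp))
            (φ + FunctionEstimation.linearFunctional α θ * t / FunctionEstimation.gammaOpt g α)) ∧
    -- the randomized protocol converges to the dephased one in probability
    (∀ (θ : Fin m → ℝ) (ε : ℝ), 0 < ε →
      Tendsto (fun L : ℕ => ProbabilityTheory.uniformOn (Set.univ : Set (Fin L → Fin N))
          {s | ε ≤ FunctionEstimation.spectralNorm
            (FunctionEstimation.qdriftProtocol K a t (x₀ :: xs) (y₀ :: ys)
                (FunctionEstimation.hamiltonian g θ) L s
              - FunctionEstimation.idealProtocol K a t (x₀ :: xs) (y₀ :: ys)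
                (FunctionEstimation.hamiltonian g θ))})
        atTop (𝓝 0)) ∧
    -- the estimator, for every initial phase and working point of nonzero slope
    ∀ (q₀ φ : ℝ), Real.cos (φ + q₀ * t / FunctionEstimation.gammaOpt g α) ≠ 0 →
      ∀ (est : ℝ → ℝ) (law : (Fin m → ℝ) → Measure ℝ) (lawL : ℕ → (Fin m → ℝ) → Measure ℝ),
      est = FunctionEstimation.estimator (FunctionEstimation.gammaOpt g α) t φ q₀ →
      law = (fun θ => FunctionEstimation.idealLaw K a t x₀ xs y₀ ys φ
        (FunctionEstimation.hamiltonian g θ)) →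
      lawL = (fun L θ => FunctionEstimation.qdriftLaw K a t x₀ xs y₀ ys φ
        (FunctionEstimation.hamiltonian g θ) L) →
      (∀ θ, IsProbabilityMeasure (law θ)) ∧
      (∀ L θ, IsProbabilityMeasure (lawL L θ)) ∧
      -- dephased evolution: local unbiasedness and variance `γ² / t²`
      (∀ θ₀ : Fin m → ℝ, FunctionEstimation.linearFunctional α θ₀ = q₀ →
        (∫ o, est o ∂(law θ₀)) = q₀ ∧
        HasFDerivAt (fun θ => ∫ o, est o ∂(law θ)) (FunctionEstimation.linearFunctional α) θ₀ ∧
        ProbabilityTheory.variance est (law θ₀)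
          = FunctionEstimation.gammaOpt g α ^ 2 / t ^ 2) ∧
      -- randomized evolution: the bias vanishes, with its gradient, and the variance converges
      (∀ θ₀ : Fin m → ℝ, FunctionEstimation.linearFunctional α θ₀ = q₀ →
        Tendsto (fun L => ∫ o, est o ∂(lawL L θ₀)) atTop (𝓝 q₀) ∧
        (∀ L, DifferentiableAt ℝ (fun θ => ∫ o, est o ∂(lawL L θ)) θ₀) ∧
        Tendsto (fun L => fderiv ℝ (fun θ => ∫ o, est o ∂(lawL L θ)) θ₀) atTop
          (𝓝 (FunctionEstimation.linearFunctional α)) ∧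
        Tendsto (fun L => ProbabilityTheory.variance est (lawL L θ₀)) atTop
          (𝓝 (FunctionEstimation.gammaOpt g α ^ 2 / t ^ 2))) ∧
      -- the effect of the randomization on the mean is uniformly small for bounded parameters
      (∀ R : ℝ, TendstoUniformlyOn (fun L θ => ∫ o, est o ∂(lawL L θ))
        (fun θ => ∫ o, est o ∂(law θ)) atTop (Metric.closedBall 0 R)) := by
  obtain hfeas := FunctionEstimation.exists_isFeasible hherm htrace hindep α
  have hγ := FunctionEstimation.gammaOpt_pos hα hfeas
  refine ⟨hγ, FunctionEstimation.exists_isOptimal hfeas, ?_⟩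
  rintro A hA K a rfl
  have hpos := FunctionEstimation.sum_positive_eigenvalues hA
  have hneg := FunctionEstimation.sum_negative_eigenvalues hA
  refine ⟨?_, ?_, fun θ => FunctionEstimation.average_clock K _, ?_⟩
  · by_contra! h
    rw [Finset.sum_eq_zero fun k _ => if_neg (not_lt.mpr (h k))] at hpos
    exact hγ.ne hpos
  · by_contra! h
    rw [Finset.sum_eq_zero fun k _ => if_neg (not_lt.mpr (h k))] at hneg
    linarith
  intro x₀ xs y₀ ys hx hxa hy hya
  have hN : N ≠ 0 := fun h => by subst h; exact x₀.elim0
  set γ := FunctionEstimation.gammaOpt g α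
  have hxs : ((x₀ :: xs).map a).sum = γ := by
    rw [FunctionEstimation.list_sum_eq_sum_ite hx hxa, hpos]
  have hys : ((y₀ :: ys).map a).sum = -γ := by
    rw [FunctionEstimation.list_sum_eq_sum_ite hy hya, hneg]
  have hdisj : ∀ k ∈ x₀ :: xs, k ∉ y₀ :: ys := fun k h h' =>
    lt_asymm ((hxa k).mp h) ((hya k).mp h')
  have hG : FunctionEstimation.IsSchedule 0 t
      (FunctionEstimation.gates K a t (x₀ :: xs) (y₀ :: ys)) := by
    refine FunctionEstimation.gates_isSchedule K a t hx hy (fun k hk => ?_) (fun k hk => ?_)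
      (by rw [hxs]; exact hγ.ne') (by rw [hys]; exact (neg_neg_of_pos hγ).ne)
    · have := (hxa k).mp hk
      rw [FunctionEstimation.dwell, hxs]
      positivity
    · have := (hya k).mp hk
      rw [FunctionEstimation.dwell, hys]
      exact div_nonneg_of_nonpos (mul_nonpos_of_nonpos_of_nonneg this.le ht.le)
        (neg_neg_of_pos hγ).le
  have hH := FunctionEstimation.isHermitian_hamiltonian hherm
  have hxy₀ : x₀ ≠ y₀ := fun h => hdisj x₀ (by simp) (by simp [h])
  have hphase : ∀ (θ : Fin m → ℝ) (φ : ℝ), ∃ c : ℂ, ‖c‖ = 1 ∧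
      FunctionEstimation.act
          (FunctionEstimation.idealProtocol K a t (x₀ :: xs) (y₀ :: ys)
            (FunctionEstimation.hamiltonian g θ))
          (FunctionEstimation.ghz K x₀ y₀ φ)
        = c • FunctionEstimation.ghz K ((x₀ :: xs).getLast (by simp))
            ((y₀ :: ys).getLast (by simp))
            (φ + FunctionEstimation.linearFunctional α θ * t / γ) := by
    intro θ φ
    refine FunctionEstimation.act_idealProtocol_ghz K a t γ hγ.ne' (hH θ) hx hy hdisj hxs hys _ ?_ φ
    rw [FunctionEstimation.list_sum_eq_sum_ite hx hxa,
      FunctionEstimation.list_sum_eq_sum_ite hy hya,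
      ← FunctionEstimation.sum_eigenvalues_mul_expectation hA.isFeasible θ,
      ← Finset.sum_add_distrib]
    refine Finset.sum_congr rfl fun k _ => ?_
    rcases lt_trichotomy (a k) 0 with h | h | h
    · simp [h, h.not_gt]
    · simp [h]
    · simp [h, h.not_gt]
  refine ⟨hphase, fun θ ε hε =>
    FunctionEstimation.tendsto_uniformOn_protocol_sub hN K a ht.le hG (hH θ) hε, ?_⟩
  rintro q₀ φ hcos est law lawL rfl rfl rfl
  set ψ := FunctionEstimation.ghz K x₀ y₀ φ with hψdef
  have hψ : ‖ψ‖ = 1 := FunctionEstimation.norm_ghz K hxy₀ φ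
  set G := FunctionEstimation.gates K a t (x₀ :: xs) (y₀ :: ys) with hGdef
  set x' := (x₀ :: xs).getLast (by simp) with hx'
  set y' := (y₀ :: ys).getLast (by simp) with hy'
  have hxy' : x' ≠ y' := fun h =>
    hdisj x' (List.getLast_mem _) (by rw [h]; exact List.getLast_mem _)
  set O := FunctionEstimation.readout K x' y' with hO
  have hmean : ∀ θ, FunctionEstimation.dephasedExpectation K t G O ψ
      (FunctionEstimation.hamiltonian g θ)
        = -Real.sin (φ + FunctionEstimation.linearFunctional α θ * t / γ) := by
    intro θ
    obtain ⟨c, hc, h⟩ := hphase θ φ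
    calc _ = FunctionEstimation.expectation O (c • FunctionEstimation.ghz K x' y'
            (φ + FunctionEstimation.linearFunctional α θ * t / γ)) := by rw [← h]; rfl
      _ = _ := by
          rw [FunctionEstimation.expectation_smul hc,
            FunctionEstimation.expectation_readout_ghz K hxy']
  have hsq : ∀ θ, FunctionEstimation.dephasedExpectation K t G (O * O) ψ
      (FunctionEstimation.hamiltonian g θ) = 1 := by
    intro θ
    obtain ⟨c, hc, h⟩ := hphase θ φ
    calc _ = FunctionEstimation.expectation (O * O) (c • FunctionEstimation.ghz K x' y'
            (φ + FunctionEstimation.linearFunctional α θ * t / γ)) := by rw [← h]; rfl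
      _ = _ := by
          rw [FunctionEstimation.expectation_smul hc,
            FunctionEstimation.expectation_readout_sq_ghz K hxy']
  have hideal : ∀ θ, IsProbabilityMeasure (FunctionEstimation.idealLaw K a t x₀ xs y₀ ys φ
      (FunctionEstimation.hamiltonian g θ)) := fun θ =>
    FunctionEstimation.isProbabilityMeasure_idealLaw K a t hG hxy₀ φ (hH θ)
  have hrand : ∀ L θ, IsProbabilityMeasure (FunctionEstimation.qdriftLaw K a t x₀ xs y₀ ys φ
      (FunctionEstimation.hamiltonian g θ) L) := fun L θ =>
    FunctionEstimation.isProbabilityMeasure_qdriftLaw hN K a t hG hxy₀ φ (hH θ) L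
  have hidealM := fun θ => FunctionEstimation.idealLaw_moments K a t x₀ xs y₀ ys φ
    (FunctionEstimation.hamiltonian g θ)
  have hrandM := fun L θ => FunctionEstimation.qdriftLaw_moments hN K a t x₀ xs y₀ ys φ
    (FunctionEstimation.hamiltonian g θ) L
  refine ⟨hideal, hrand, ?_⟩
  set Φ₀ := φ + q₀ * t / γ with hΦ₀
  set c₁ := (-(t / γ) * Real.cos Φ₀)⁻¹ with hc₁
  set c₀ := q₀ + Real.sin Φ₀ * c₁ with hc₀
  have hest : FunctionEstimation.estimator γ t φ q₀ = fun o => c₀ + c₁ * o :=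
    FunctionEstimation.estimator_eq γ t φ q₀
  -- the estimator is affine in the outcome, so only the first two moments of the outcome enter
  have hidealE : ∀ θ, ∫ o, FunctionEstimation.estimator γ t φ q₀ o
      ∂(FunctionEstimation.idealLaw K a t x₀ xs y₀ ys φ (FunctionEstimation.hamiltonian g θ))
      = c₀ + c₁ * FunctionEstimation.dephasedExpectation K t G O ψ
        (FunctionEstimation.hamiltonian g θ) := by
    intro θ
    have := hideal θ
    rw [hest, FunctionEstimation.integral_affine (hidealM θ).1, (hidealM θ).2.1]
  have hrandE : ∀ L θ, ∫ o, FunctionEstimation.estimator γ t φ q₀ o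
      ∂(FunctionEstimation.qdriftLaw K a t x₀ xs y₀ ys φ (FunctionEstimation.hamiltonian g θ) L)
      = c₀ + c₁ * FunctionEstimation.randomizedExpectation K t G O ψ L
        (FunctionEstimation.hamiltonian g θ) := by
    intro L θ
    have := hrand L θ
    rw [hest, FunctionEstimation.integral_affine (hrandM L θ).1, (hrandM L θ).2.1]
  simp only [hidealE, hrandE]
  have hγt : t / γ ≠ 0 := (div_pos ht hγ).ne'
  -- `c₁` is the reciprocal of the derivative of the mean outcome with respect to `q`
  have hc₁slope : c₁ * (-(Real.cos Φ₀ * (t / γ))) = 1 := by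
    rw [hc₁]
    field_simp
  have hcenter : c₀ + c₁ * -Real.sin Φ₀ = q₀ := by
    rw [hc₀]
    ring
  have hvar : c₁ ^ 2 * (1 - (-Real.sin Φ₀) ^ 2) = γ ^ 2 / t ^ 2 := by
    rw [neg_sq, ← Real.cos_sq', hc₁]
    field_simp
  have hderiv : ∀ θ₀, FunctionEstimation.linearFunctional α θ₀ = q₀ →
      HasFDerivAt (fun θ => FunctionEstimation.dephasedExpectation K t G O ψ
        (FunctionEstimation.hamiltonian g θ))
        ((-(Real.cos Φ₀ * (t / γ))) • FunctionEstimation.linearFunctional α) θ₀ := by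
    intro θ₀ hθ₀
    have h1 : HasFDerivAt (fun θ => φ + FunctionEstimation.linearFunctional α θ * (t / γ))
        ((t / γ) • FunctionEstimation.linearFunctional α) θ₀ :=
      ((FunctionEstimation.linearFunctional α).hasFDerivAt.mul_const (t / γ)).const_add φ
    have h2 := h1.sin.neg
    have h3 : φ + FunctionEstimation.linearFunctional α θ₀ * (t / γ) = Φ₀ := by
      rw [hθ₀, hΦ₀, mul_div_assoc]
    rw [h3, smul_smul, ← neg_smul] at h2
    refine h2.congr_of_eventuallyEq (Eventually.of_forall fun θ => ?_)
    simp only [hmean, mul_div_assoc]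
    rfl
  refine ⟨fun θ₀ hθ₀ => ⟨?_, ?_, ?_⟩, fun θ₀ hθ₀ => ⟨?_, fun L => ?_, ?_, ?_⟩, fun R => ?_⟩
  · rw [hmean, hθ₀, hcenter]
  · have := ((hderiv θ₀ hθ₀).const_mul c₁).const_add c₀
    rwa [smul_smul, hc₁slope, one_smul] at this
  · have := hideal θ₀
    rw [hest, FunctionEstimation.variance_affine (hidealM θ₀).1, (hidealM θ₀).2.1,
      (hidealM θ₀).2.2, hsq, hmean, hθ₀, hvar]
  · have := ((FunctionEstimation.tendsto_randomizedExpectation hN K ht.le hG O hψ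
      (hH θ₀)).const_mul c₁).const_add c₀
    rwa [hmean, hθ₀, hcenter] at this
  · exact ((FunctionEstimation.differentiable_randomizedExpectation K t G O ψ g L
      θ₀).const_mul c₁).const_add c₀
  · have h1 := (FunctionEstimation.tendsto_fderiv_randomizedExpectation hN K ht.le hG O hψ hherm θ₀
      (hderiv θ₀ hθ₀)).const_smul c₁
    rw [smul_smul, hc₁slope, one_smul] at h1
    refine h1.congr fun L => ?_
    rw [fderiv_const_add, fderiv_const_mul
      (FunctionEstimation.differentiable_randomizedExpectation K t G O ψ g L θ₀)]
  · have h1 := FunctionEstimation.tendsto_randomizedExpectation hN K ht.le hG O hψ (hH θ₀)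
    have h2 := FunctionEstimation.tendsto_randomizedExpectation hN K ht.le hG (O * O) hψ (hH θ₀)
    have h3 := (h2.sub (h1.pow 2)).const_mul (c₁ ^ 2)
    rw [hsq, hmean, hθ₀, hvar] at h3
    refine h3.congr fun L => ?_
    have := hrand L θ₀
    rw [hest, FunctionEstimation.variance_affine (hrandM L θ₀).1, (hrandM L θ₀).2.1,
      (hrandM L θ₀).2.2]
  · have h1 := FunctionEstimation.tendstoUniformlyOn_randomizedExpectation hN K ht.le hG O hψ
      hherm R
    have haff : UniformContinuous fun r : ℝ => c₀ + c₁ • r :=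
      uniformContinuous_const.add (uniformContinuous_id.const_smul c₁)
    exact haff.comp_tendstoUniformlyOn h1
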